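/- **Channel.** Let $K\ge 1$, $P>0$, $\sigma_F,\sigma_N\ge 0$. In channel use $t=0,1,2,\dots$ the transmitters $1,\dots,K$ send symbols $x_k(t)\in\mathbb C$ with $|x_k(t)|^2\le P$, and the receiver (the coordinator) observes $Y(t)=\sum_{k=1}^K H_k(t)x_k(t)+N(t)$. The real and imaginary parts of all $H_k(t)$ and all $N(t)$ are jointly independent with mean zero; the real and imaginary parts of $H_k(t)$ have variance $1$ and sub-gaussian norm at most $\sigma_F$, those of $N(t)$ have sub-gaussian norm at most $\sigma_N$, where $\tau(X)=\inf\{t>0:\ \mathbb E e^{\lambda(X-\mathbb EX)}\le e^{\lambda^2t^2/2}\ \forall\lambda\in\mathbb R\}$. Transmitter $k$ also has independent uniform random signs $U_k(t)\in\{-1,1\}$, independent of the channel. In addition the coordinator can multicast digital messages noiselessly to all agents. **Problem.** The agents $1,\dots,K$ hold pairwise distinct inputs $s_1,\dots,s_K$ from a totally ordered set $\mathcal S$, which is represented by infinite binary sequences through a strictly increasing map $\varphi:\mathcal S\to\{0,1\}^{\infty}$ (lexicographic order). The *maximum description length* $d$ is the maximum over $k$ of the least number of leading bits of $\varphi(s_k)$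 that distinguish it from all $\varphi(s_j)$, $j\ne k$. *Weak $m$-max-consensus* is reached if every agent has decided whether it belongs to the set of remaining agents, where this set is nonempty, has at most $m$ elements, and each of its members holds a larger input than every agent outside it (so it contains the agent with the maximal input). **Scheme (ScalableMax over the fading channel).** Fix integers $M,m>0$ with $m$ even. All parties keep a binary word $x$, initially empty. In each step the coordinator forms estimates $e_0,e_1,e_2$ of the numbers of agents $k$ for which, respectively, $\varphi(s_k)$ is lexicographically above all sequences with prefix $x$; $\varphi(s_k)$ has prefix $x$; $\varphi(s_k)$ has prefix $x1$. For each of the three estimates $M$ channel uses are made: an agent for which the condition holds transmits $\sqrt P\,U_k(t)$, the other agents transmit $0$, and the coordinator computes $\frac1{2MP}\sum_t\left(|Y(t)|^2-\mathbb E|N(t)|^2\right)$, the sum being over these $M$ uses. Then it makes one multicast: if $e_0\ge m/4$, the scheme ends and the agents above $x$ remain; otherwise, if $e_1<m/4+1$, the scheme ends and the agents above $x$ or with prefix $x$ remain; otherwise the bit $1$ (if $e_2\ge m/4$) or $0$ (if $e_2<m/4$) is appended to $x$ and the next step follows. **Claim.** With $\varepsilon=m/4$ and $L=3\sigma_F^2K+\frac{4\sigma_N\sigma_F\sqrt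 K}{\sqrt P}+\frac{2\sigma_N^2}{P}$, let $$\gamma=2\exp\left(-\frac{M\varepsilon^2}{4\sigma_F^2\varepsilon+32K\sigma_F^4}\right)+2\exp\left(-\frac{M\varepsilon^2}{4L\varepsilon+16L^2}\right)$$ and suppose that $\gamma\le 1$. Then the scheme respects the power constraint almost surely, and with probability at least $(1-\gamma)^{3(d+1)}$ it ends with weak $m$-max-consensus after at most $3M(d+1)$ uses of the channel and at most $M(d+1)$ digital multicasts. -/

import Mathlib

open MeasureTheory ProbabilityTheory
open scoped NNReal ENNReal

namespace MaxConsensus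

noncomputable section

/-! ### The fast-fading multiple-access channel -/

/-- The sub-gaussian norm `τ(X)`: the infimum of all `t > 0` such that
`𝔼 exp (lam * (X - 𝔼 X)) ≤ exp (lam ^ 2 * t ^ 2 / 2)` for every real `lam`
(it is `∞` if there is no such `t`). -/
def subGaussianNorm {Ω : Type*} [MeasurableSpace Ω] (X : Ω → ℝ) (μ : Measure Ω) : ℝ≥0∞ :=
  ⨅ t : {t : ℝ≥0 // 0 < t ∧ HasSubgaussianMGF (fun ω => X ω - ∫ ω', X ω' ∂μ) (t ^ 2) μ},
    ((t : ℝ≥0) : ℝ≥0∞)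

/-- The real random sources that act in one use of the channel with `K` transmitters: real and
imaginary part of each fading coefficient, real and imaginary part of the additive noise, and the
local random sign of each transmitter. -/
inductive Source (K : ℕ) : Type
  | fadingRe (k : Fin K)
  | fadingIm (k : Fin K)
  | noiseRe
  | noiseIm
  | sign (k : Fin K)

/-- The random variable that belongs to a source in the `t`-th channel use. -/
def sourceVar {Ω : Type*} {K : ℕ} (H : ℕ → Fin K → Ω → ℂ) (N : ℕ → Ω → ℂ)
    (U : ℕ → Fin K → Ω → ℝ) : ℕ × Source K → Ω → ℝ
  | (t, .fadingRe k), ω => (H t k ω).re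
  | (t, .fadingIm k), ω => (H t k ω).im
  | (t, .noiseRe), ω => (N t ω).re
  | (t, .noiseIm), ω => (N t ω).im
  | (t, .sign k), ω => U t k ω

/-- The probabilistic assumptions on the channel: `H t k` is the fading coefficient of transmitter
`k` and `N t` the additive noise in channel use `t`; `U t k` is the local randomness of
transmitter `k`, a uniformly distributed sign. -/
structure IsFadingChannel {Ω : Type*} [MeasurableSpace Ω] (μ : Measure Ω) {K : ℕ}
    (H : ℕ → Fin K → Ω → ℂ) (N : ℕ → Ω → ℂ) (U : ℕ → Fin K → Ω → ℝ) (σF σN : ℝ) : Prop where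
  measurable_fading : ∀ t k, Measurable (H t k)
  measurable_noise : ∀ t, Measurable (N t)
  measurable_sign : ∀ t k, Measurable (U t k)
  indep : iIndepFun (sourceVar H N U) μ
  fading_mean_re : ∀ t k, ∫ ω, (H t k ω).re ∂μ = 0
  fading_mean_im : ∀ t k, ∫ ω, (H t k ω).im ∂μ = 0
  fading_var_re : ∀ t k, variance (fun ω => (H t k ω).re) μ = 1
  fading_var_im : ∀ t k, variance (fun ω => (H t k ω).im) μ = 1
  fading_norm_re : ∀ t k, subGaussianNorm (fun ω => (H t k ω).re) μ ≤ ENNReal.ofReal σF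
  fading_norm_im : ∀ t k, subGaussianNorm (fun ω => (H t k ω).im) μ ≤ ENNReal.ofReal σF
  noise_mean_re : ∀ t, ∫ ω, (N t ω).re ∂μ = 0
  noise_mean_im : ∀ t, ∫ ω, (N t ω).im ∂μ = 0
  noise_norm_re : ∀ t, subGaussianNorm (fun ω => (N t ω).re) μ ≤ ENNReal.ofReal σN
  noise_norm_im : ∀ t, subGaussianNorm (fun ω => (N t ω).im) μ ≤ ENNReal.ofReal σN
  sign_pos : ∀ t k, μ {ω | U t k ω = 1} = 1 / 2
  sign_neg : ∀ t k, μ {ω | U t k ω = -1} = 1 / 2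

/-- `Y(t) = ∑ₖ Hₖ(t) xₖ(t) + N(t)`. -/
def channelOutput {Ω : Type*} {K : ℕ} (H : ℕ → Fin K → Ω → ℂ) (N : ℕ → Ω → ℂ) (t : ℕ)
    (x : Fin K → ℂ) (ω : Ω) : ℂ :=
  ∑ k, H t k ω * x k + N t ω

/-! ### Protocols in a star-shaped network -/

/-- A protocol for `K` agents with inputs in `α` and a coordinator. It proceeds in steps; a step
consists of `uses` uses of the multiple-access channel from the agents to the coordinator, followed
by one noiseless digital multicast from the coordinator to all agents. An agent knows its own input,
the multicasts so far, and its local randomness; the coordinator knows the channel outputs. -/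
structure StarProtocol (K : ℕ) (α Msg : Type*) where
  /-- number of channel uses in one step -/
  uses : ℕ
  /-- symbol sent by an agent: own input, multicasts so far, use within the step, local randomness -/
  symbol : Fin K → α → List Msg → Fin uses → ℝ → ℂ
  /-- the next multicast, from the multicasts so far and the channel outputs in this step -/
  multicast : List Msg → (Fin uses → ℂ) → Msg
  /-- whether the protocol has ended after these multicasts -/
  halted : List Msg → Bool
  /-- the final decision of an agent, from its own input and the multicasts -/
  decision : Fin K → α → List Msg → Bool

namespace StarProtocol

variable {K : ℕ} {α Msg Ω : Type*}

/-- The symbol transmitted by agent `k` in the `i`-th use of the step that follows the multicasts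
`h`; that step is step number `h.length`, so this is channel use `uses * h.length + i`. -/
def transmitted (p : StarProtocol K α Msg) (s : Fin K → α) (U : ℕ → Fin K → Ω → ℝ)
    (h : List Msg) (i : Fin p.uses) (k : Fin K) (ω : Ω) : ℂ :=
  p.symbol k (s k) h i (U (p.uses * h.length + i) k ω)

/-- The sequence of all multicasts in the first `t` steps (fewer if the protocol ends earlier). -/
def transcript (p : StarProtocol K α Msg) (s : Fin K → α) (H : ℕ → Fin K → Ω → ℂ)
    (N : ℕ → Ω → ℂ) (U : ℕ → Fin K → Ω → ℝ) (ω : Ω) : ℕ → List Msg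
  | 0 => []
  | t + 1 =>
    let h := transcript p s H N U ω t
    if p.halted h then h
    else h ++ [p.multicast h fun i =>
      channelOutput H N (p.uses * h.length + i) (fun k => p.transmitted s U h i k ω) ω]

/-- Peak power constraint: almost surely, no transmitted symbol has a power above `P`. -/
def PeakPowerConstraint [MeasurableSpace Ω] (p : StarProtocol K α Msg) (μ : Measure Ω)
    (s : Fin K → α) (H : ℕ → Fin K → Ω → ℂ) (N : ℕ → Ω → ℂ) (U : ℕ → Fin K → Ω → ℝ)
    (P : ℝ) : Prop :=
  ∀ᵐ ω ∂μ, ∀ (t : ℕ) (i : Fin p.uses) (k : Fin K),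
    ‖p.transmitted s U (p.transcript s H N U ω t) i k ω‖ ^ 2 ≤ P

end StarProtocol

/-- Weak `m`-max-consensus: every agent has decided whether it belongs to the set of remaining
agents; this set is nonempty, has at most `m` elements, and its members hold larger inputs than all
other agents (so every agent with the maximal input belongs to it). -/
def WeakMaxConsensus {K : ℕ} {α : Type*} [LinearOrder α] (m : ℕ) (s : Fin K → α)
    (out : Fin K → Bool) : Prop :=
  (∃ k, out k = true) ∧ {k | out k = true}.ncard ≤ m ∧
    ∀ i j, out i = true → out j = false → s j < s i

/-- The protocol ends with weak `m`-max-consensus after at most `a` channel uses and at most `b`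
multicasts. Each step contributes one multicast to the transcript. -/
def StarProtocol.Reaches {K : ℕ} {α Msg Ω : Type*} [LinearOrder α] (p : StarProtocol K α Msg)
    (m : ℕ) (s : Fin K → α) (H : ℕ → Fin K → Ω → ℂ) (N : ℕ → Ω → ℂ) (U : ℕ → Fin K → Ω → ℝ)
    (a b : ℕ) (ω : Ω) : Prop :=
  ∃ t : ℕ, p.halted (p.transcript s H N U ω t) = true ∧
    p.uses * (p.transcript s H N U ω t).length ≤ a ∧
    (p.transcript s H N U ω t).length ≤ b ∧
    WeakMaxConsensus m s fun k => p.decision k (s k) (p.transcript s H N U ω t)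

/-! ### Binary descriptions -/

/-- The first `n` bits of an infinite binary sequence. -/
def bitPrefix (b : Lex (ℕ → Bool)) (n : ℕ) : List Bool :=
  (List.range n).map (ofLex b)

/-- The number of leading bits needed to tell the sequence of agent `k` from those of all others. -/
def descriptionLength {K : ℕ} (b : Fin K → Lex (ℕ → Bool)) (k : Fin K) : ℕ :=
  sInf {n | ∀ j, j ≠ k → bitPrefix (b j) n ≠ bitPrefix (b k) n}

/-- The maximum description length `d` of the agents' sequences. -/
def maxDescriptionLength {K : ℕ} (b : Fin K → Lex (ℕ → Bool)) : ℕ :=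
  Finset.univ.sup (descriptionLength b)

/-- The sequence `b` starts with the word `x`. -/
def HasPrefix (x : List Bool) (b : Lex (ℕ → Bool)) : Prop :=
  bitPrefix b x.length = x

/-- The sequence `b` is lexicographically above all sequences that start with the word `x`. -/
def IsAbove (x : List Bool) (b : Lex (ℕ → Bool)) : Prop :=
  x < bitPrefix b x.length

/-! ### Approximation of a sum over the fading channel -/

/-- Pre-processing for the sum function on `[0,1]^K`: `√(P s) U`. -/
def sumEncode (P s u : ℝ) : ℂ :=
  ((Real.sqrt (P * s) * u : ℝ) : ℂ)

/-- Post-processing for the sum function: received energy minus expected noise energy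
`ν i = 𝔼 |N(i)|²`, normalized. -/
def sumDecode (P : ℝ) {M : ℕ} (ν : Fin M → ℝ) (y : Fin M → ℂ) : ℝ :=
  (∑ i, ‖y i‖ ^ 2 - ∑ i, ν i) / (2 * M * P)

/-- The bound `Γ₁ + Γ₂` on the probability that the sum function on `[0,1]^K` is approximated with
an error of at least `ε` after `M` channel uses. -/
def sumErrorBound (M K : ℕ) (σF σN P ε : ℝ) : ℝ :=
  let L : ℝ := 3 * σF ^ 2 * K + 4 * σN * σF * Real.sqrt K / Real.sqrt P + 2 * σN ^ 2 / P
  2 * Real.exp (-(M * ε ^ 2 / (4 * σF ^ 2 * ε + 32 * K * σF ^ 4))) +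
    2 * Real.exp (-(M * ε ^ 2 / (4 * L * ε + 16 * L ^ 2)))

/-! ### ScalableMax -/

/-- Digital messages of the coordinator: append a bit to the current word, or end the protocol. In
the latter case the flag says whether the agents whose sequences start with the current word remain,
in addition to the agents above it. -/
inductive Message : Type
  | append (b : Bool)
  | finish (withPrefix : Bool)

/-- The current word: all bits appended so far. -/
def currentWord (h : List Message) : List Bool :=
  h.filterMap fun
    | .append b => some b
    | .finish _ => none

/-- The three questions of a step: the agents above the current word `x`, the agents whose
sequences start with `x`, and the agents whose sequences start with `x` followed by the bit `1`. -/
def Query (x : List Bool) (b : Lex (ℕ → Bool)) (q : Fin 3) : Prop :=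
  ![IsAbove x b, HasPrefix x b, HasPrefix (x ++ [true]) b] q

/-- The coordinator's reaction to the estimates `e 0, e 1, e 2` of the numbers of agents which
answer the three questions in the affirmative. -/
def react (m : ℕ) (e : Fin 3 → ℝ) : Message :=
  if (m : ℝ) / 4 ≤ e 0 then .finish false
  else if e 1 < (m : ℝ) / 4 + 1 then .finish true
  else if (m : ℝ) / 4 ≤ e 2 then .append true
  else .append false

open Classical in
/-- ScalableMax with each idealized channel use replaced by `M` uses of the fading channel. The
agents' inputs are represented by binary sequences through `φ`, and `ν t` is the noise energy that
the coordinator expects in channel use `t`. Use number `i + M * q` of a step serves question `q`. -/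
def scalableMax (K M m : ℕ) {α : Type*} (φ : α → Lex (ℕ → Bool)) (P : ℝ) (ν : ℕ → ℝ) :
    StarProtocol K α Message where
  uses := 3 * M
  symbol _ a h i u :=
    sumEncode P (if Query (currentWord h) (φ a) (finProdFinEquiv.symm i).1 then 1 else 0) u
  multicast h y := react m fun q =>
    sumDecode P (fun i : Fin M => ν (3 * M * h.length + (finProdFinEquiv (q, i) : Fin (3 * M))))
      (fun i : Fin M => y (finProdFinEquiv (q, i)))
  halted h := match h.getLast? with
    | some (.finish _) => true
    | _ => false
  decision _ a h := match h.getLast? with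
    | some (.finish withPrefix) =>
      decide (IsAbove (currentWord h) (φ a) ∨
        (withPrefix = true ∧ HasPrefix (currentWord h) (φ a)))
    | _ => false

end

end MaxConsensus

open MaxConsensus

/-!
The signs and the fading make each channel output a sum of independent centred sub-gaussian
variables, so `E |Y(t)| ^ 2 - E |N(t)| ^ 2` is `2 * P` times the number of transmitting agents.
The energy `|Y(t)| ^ 2` has a finite exponential moment, and a Bernstein bound over `M` channel uses
shows that an estimate misses by `m / 4` or more with probability at most `γ`.

Which agents transmit depends on the past only through the multicasts. These are determined by
earlier channel uses, hence independent of those of the current step: conditionally on any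
transcript, all three estimates of a step are accurate with probability at least `(1 - γ) ^ 3`.

As long as the estimates are accurate, some agent is above the current word `x` or has the prefix
`x`, and at most `m` agents are above `x`. A bit is appended only while at least two
agents share the prefix `x`, so the word never gets longer than `d` and the run ends within `d + 1`
steps.
-/

namespace MaxConsensus

/-! ### Exponential moments and Bernstein's inequality -/

theorem exp_mul_sub_le_sq_mul {θ : ℝ} (hθ : |θ| ≤ 1) (z : ℝ) :
    Real.exp (θ * z) - 1 - θ * z ≤ θ ^ 2 * (Real.exp |z| - 1 - |z|) := by
  have hasSum_tail (y : ℝ) :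
      HasSum (fun n : ℕ => y ^ (n + 2) / (n + 2).factorial) (Real.exp y - 1 - y) := by
    have hsum : HasSum (fun n : ℕ => y ^ n / n.factorial) (Real.exp y) := by
      rw [Real.exp_eq_exp_ℝ]
      exact NormedSpace.expSeries_div_hasSum_exp y
    rw [← hasSum_nat_add_iff' 2] at hsum
    simpa [Finset.sum_range_succ, sub_sub] using hsum
  refine hasSum_le (fun n => ?_) (hasSum_tail (θ * z)) ((hasSum_tail |z|).mul_left (θ ^ 2))
  rw [← mul_div_assoc]
  gcongr
  calc (θ * z) ^ (n + 2) ≤ |(θ * z) ^ (n + 2)| := le_abs_self _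
    _ = |θ| ^ n * (θ ^ 2 * |z| ^ (n + 2)) := by
      rw [abs_pow, abs_mul, mul_pow, pow_add |θ|, sq_abs, mul_assoc]
    _ ≤ θ ^ 2 * |z| ^ (n + 2) :=
      mul_le_of_le_one_left (by positivity) (pow_le_one₀ (abs_nonneg θ) hθ)

theorem lintegral_exp_mul_sq_gaussianReal {t : ℝ} (ht : 2 * t < 1) :
    ∫⁻ g, ENNReal.ofReal (Real.exp (t * g ^ 2)) ∂(gaussianReal 0 1) =
      ENNReal.ofReal (√(1 - 2 * t))⁻¹ := by
  have hpos : 0 < 1 / 2 - t := by linarith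
  have density (g : ℝ) : (gaussianPDF 0 1 * fun g => ENNReal.ofReal (Real.exp (t * g ^ 2))) g =
      ENNReal.ofReal ((√(2 * Real.pi))⁻¹ * Real.exp (-(1 / 2 - t) * g ^ 2)) := by
    rw [Pi.mul_apply, gaussianPDF, ← ENNReal.ofReal_mul (gaussianPDFReal_nonneg _ _ _)]
    simp only [gaussianPDFReal, NNReal.coe_one, mul_one, sub_zero]
    rw [mul_assoc, ← Real.exp_add]
    ring_nf
  rw [gaussianReal_of_var_ne_zero _ one_ne_zero,
    lintegral_withDensity_eq_lintegral_mul _ (measurable_gaussianPDF 0 1) (by fun_prop),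
    lintegral_congr density, ← ofReal_integral_eq_lintegral_ofReal
      ((integrable_exp_neg_mul_sq hpos).const_mul _) (ae_of_all _ fun g => by positivity),
    integral_const_mul, integral_gaussian, ← Real.sqrt_inv, ← Real.sqrt_inv,
    ← Real.sqrt_mul (by positivity)]
  congr 2
  have : 1 - 2 * t ≠ 0 := by linarith
  field_simp

section SubGaussian

variable {Ω : Type*} [MeasurableSpace Ω] {μ : Measure Ω}

theorem hasSubgaussianMGF_mono {X : Ω → ℝ} {c c' : ℝ≥0} (h : HasSubgaussianMGF X c μ)
    (hc : c ≤ c') : HasSubgaussianMGF X c' μ := by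
  refine ⟨h.integrable_exp_mul, fun t => (h.mgf_le t).trans ?_⟩
  have : (c : ℝ) ≤ c' := hc
  gcongr

-- Substitute `exp (t * x ^ 2) = E exp (√(2 * t) * x * g)` with a standard gaussian `g` and
-- integrate over `ω` first.
theorem lintegral_exp_mul_sq_le [IsFiniteMeasure μ] {X : Ω → ℝ} {v : ℝ≥0}
    (h : HasSubgaussianMGF X v μ) {t : ℝ} (ht : 0 ≤ t) (htv : 2 * (t * v) < 1) :
    ∫⁻ ω, ENNReal.ofReal (Real.exp (t * X ω ^ 2)) ∂μ ≤
      ENNReal.ofReal (√(1 - 2 * (t * v)))⁻¹ := by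
  have hX : AEMeasurable X μ := h.aemeasurable
  set r : ℝ := √(2 * t)
  have hr_sq : r ^ 2 = 2 * t := Real.sq_sqrt (by positivity)
  have gaussian_average (x : ℝ) : ENNReal.ofReal (Real.exp (t * x ^ 2)) =
      ∫⁻ g, ENNReal.ofReal (Real.exp (r * x * g)) ∂(gaussianReal 0 1) := by
    rw [← ofReal_integral_eq_lintegral_ofReal (integrable_exp_mul_gaussianReal _)
      (ae_of_all _ fun g => by positivity)]
    have hmgf := congrFun (mgf_fun_id_gaussianReal (μ := 0) (v := 1)) (r * x)
    simp only [mgf] at hmgf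
    rw [hmgf, mul_pow, hr_sq]
    congr 2
    push_cast
    ring
  simp_rw [gaussian_average]
  rw [lintegral_lintegral_swap (by fun_prop), ← lintegral_exp_mul_sq_gaussianReal htv]
  refine lintegral_mono fun g => ?_
  simp_rw [mul_right_comm r _ g]
  rw [← ofReal_integral_eq_lintegral_ofReal (h.integrable_exp_mul _)
    (ae_of_all _ fun g => by positivity)]
  refine ENNReal.ofReal_le_ofReal ((h.mgf_le (r * g)).trans_eq ?_)
  rw [mul_pow, hr_sq]
  ring_nf

theorem integrable_exp_mul_sq [IsFiniteMeasure μ] {X : Ω → ℝ} {v : ℝ≥0}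
    (h : HasSubgaussianMGF X v μ) {t : ℝ} (ht : 0 ≤ t) (htv : 2 * (t * v) < 1) :
    Integrable (fun ω => Real.exp (t * X ω ^ 2)) μ := by
  have hX : AEMeasurable X μ := h.aemeasurable
  refine ⟨by fun_prop, ?_⟩
  rw [hasFiniteIntegral_iff_ofReal (ae_of_all _ fun ω => by positivity)]
  exact (lintegral_exp_mul_sq_le h ht htv).trans_lt ENNReal.ofReal_lt_top

theorem mgf_sq_le [IsFiniteMeasure μ] {X : Ω → ℝ} {v : ℝ≥0} (h : HasSubgaussianMGF X v μ) {t : ℝ}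
    (ht : 0 ≤ t) (htv : 2 * (t * v) < 1) :
    mgf (fun ω => X ω ^ 2) μ t ≤ (√(1 - 2 * (t * v)))⁻¹ := by
  rw [mgf, integral_eq_lintegral_of_nonneg_ae (ae_of_all _ fun ω => by positivity)
    (integrable_exp_mul_sq h ht htv).aestronglyMeasurable]
  exact ENNReal.toReal_le_of_le_ofReal (by positivity) (lintegral_exp_mul_sq_le h ht htv)

theorem exp_mul_normSq_le (t : ℝ) (z : ℂ) :
    Real.exp (t * ‖z‖ ^ 2) ≤
      (Real.exp (2 * t * z.re ^ 2) + Real.exp (2 * t * z.im ^ 2)) / 2 := by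
  have hnorm : t * ‖z‖ ^ 2 = t * z.re ^ 2 + t * z.im ^ 2 := by
    rw [Complex.sq_norm, Complex.normSq_apply]
    ring
  have hexp (y : ℝ) : Real.exp (2 * t * y ^ 2) = Real.exp (t * y ^ 2) ^ 2 := by
    rw [← Real.exp_nat_mul]
    ring_nf
  rw [hnorm, Real.exp_add, hexp, hexp]
  linarith [two_mul_le_add_sq (Real.exp (t * z.re ^ 2)) (Real.exp (t * z.im ^ 2))]

section Complex

variable [IsFiniteMeasure μ] {Z : Ω → ℂ} {v : ℝ≥0}
  (hre : HasSubgaussianMGF (fun ω => (Z ω).re) v μ)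
  (him : HasSubgaussianMGF (fun ω => (Z ω).im) v μ)
  {t : ℝ} (ht : 0 ≤ t) (htv : 4 * (t * v) < 1)

include hre him ht htv

theorem integrable_exp_mul_normSq : Integrable (fun ω => Real.exp (t * ‖Z ω‖ ^ 2)) μ := by
  have hZ : AEMeasurable Z μ := aemeasurable_of_re_im hre.aemeasurable him.aemeasurable
  refine Integrable.mono'
    (((integrable_exp_mul_sq hre (t := 2 * t) (by positivity) (by linarith)).add
      (integrable_exp_mul_sq him (t := 2 * t) (by positivity) (by linarith))).div_const 2)
    (by fun_prop) (ae_of_all _ fun ω => ?_)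
  rw [Real.norm_of_nonneg (Real.exp_pos _).le]
  exact exp_mul_normSq_le t (Z ω)

theorem mgf_normSq_le : mgf (fun ω => ‖Z ω‖ ^ 2) μ t ≤ (√(1 - 4 * (t * v)))⁻¹ := by
  have htv' : 2 * (2 * t * v) < 1 := by linarith
  have hre_int := integrable_exp_mul_sq hre (t := 2 * t) (by positivity) htv'
  have him_int := integrable_exp_mul_sq him (t := 2 * t) (by positivity) htv'
  have hre_le := mgf_sq_le hre (t := 2 * t) (by positivity) htv'
  have him_le := mgf_sq_le him (t := 2 * t) (by positivity) htv'
  have hconst : 2 * (2 * t * v) = 4 * (t * v) := by ring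
  rw [hconst] at hre_le him_le
  calc mgf (fun ω => ‖Z ω‖ ^ 2) μ t
      ≤ ∫ ω, (Real.exp (2 * t * (Z ω).re ^ 2) + Real.exp (2 * t * (Z ω).im ^ 2)) / 2 ∂μ :=
        integral_mono (integrable_exp_mul_normSq hre him ht htv) ((hre_int.add him_int).div_const 2)
          fun ω => exp_mul_normSq_le t (Z ω)
    _ = (mgf (fun ω => (Z ω).re ^ 2) μ (2 * t) + mgf (fun ω => (Z ω).im ^ 2) μ (2 * t)) / 2 := by
        rw [integral_div, integral_add hre_int him_int]
        rfl
    _ ≤ (√(1 - 4 * (t * v)))⁻¹ := by linarith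

end Complex

theorem hasSubgaussianMGF_of_subGaussianNorm_le {X : Ω → ℝ} {σ : ℝ≥0}
    (h : subGaussianNorm X μ ≤ σ) :
    HasSubgaussianMGF (fun ω => X ω - ∫ ω', X ω' ∂μ) (σ ^ 2) μ := by
  have exists_param (r : ℝ≥0) (hr : σ < r) : ∃ t : ℝ≥0, t < r ∧
      HasSubgaussianMGF (fun ω => X ω - ∫ ω', X ω' ∂μ) (t ^ 2) μ := by
    obtain ⟨⟨t, _, ht⟩, htr⟩ := iInf_lt_iff.1 (h.trans_lt (ENNReal.coe_lt_coe.2 hr))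
    exact ⟨t, ENNReal.coe_lt_coe.1 htr, ht⟩
  refine ⟨?_, fun l => ?_⟩
  · obtain ⟨t, -, ht⟩ := exists_param (σ + 1) (by simp)
    exact ht.integrable_exp_mul
  · have hlim : Filter.Tendsto (fun r : ℝ≥0 => Real.exp ((r ^ 2 : ℝ≥0) * l ^ 2 / 2))
        (nhdsWithin σ (Set.Ioi σ)) (nhds (Real.exp ((σ ^ 2 : ℝ≥0) * l ^ 2 / 2))) :=
      (Continuous.tendsto (by fun_prop) σ).mono_left nhdsWithin_le_nhds
    refine ge_of_tendsto hlim ?_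
    filter_upwards [self_mem_nhdsWithin] with r hr
    obtain ⟨t, htr, ht⟩ := exists_param r hr
    refine (ht.mgf_le l).trans ?_
    gcongr

end SubGaussian

section Subexponential

variable {Ω : Type*} [MeasurableSpace Ω] {μ : Measure Ω} [IsProbabilityMeasure μ] {Y : Ω → ℝ}
  {t : ℝ}

theorem exp_mul_integral_le_mgf (hint : Integrable Y μ)
    (hexp : Integrable (fun ω => Real.exp (t * Y ω)) μ) :
    Real.exp (t * ∫ ω, Y ω ∂μ) ≤ mgf Y μ t := by
  rw [← integral_const_mul]
  exact convexOn_exp.map_integral_le Real.continuous_exp.continuousOn isClosed_univ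
    (ae_of_all _ fun _ => Set.mem_univ _) (hint.const_mul t) hexp

variable (ht : 0 < t) (hY : 0 ≤ Y) (hexp : Integrable (fun ω => Real.exp (t * Y ω)) μ)

include ht hY hexp

theorem integrable_of_integrable_exp_mul_of_nonneg : Integrable Y μ := by
  have hYm : AEMeasurable Y μ :=
    aemeasurable_of_integrable_exp_mul ht.ne' hexp (by simp : Integrable _ μ) (v := 0)
  refine (hexp.div_const t).mono' hYm.aestronglyMeasurable (ae_of_all _ fun ω => ?_)
  rw [Real.norm_of_nonneg (hY ω), le_div_iff₀' ht]
  linarith [Real.add_one_le_exp (t * Y ω)]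

omit [IsProbabilityMeasure μ] hexp in
theorem exp_abs_mul_sub_integral_le (ω : Ω) :
    Real.exp |t * (Y ω - ∫ ω', Y ω' ∂μ)| ≤
      Real.exp (t * Y ω) + Real.exp (t * ∫ ω', Y ω' ∂μ) - 1 := by
  have hmean : 0 ≤ t * ∫ ω', Y ω' ∂μ := mul_nonneg ht.le (integral_nonneg hY)
  have hvalue : 0 ≤ t * Y ω := mul_nonneg ht.le (hY ω)
  rw [mul_sub]
  rcases abs_cases (t * Y ω - t * ∫ ω', Y ω' ∂μ) with ⟨habs, -⟩ | ⟨habs, -⟩ <;> rw [habs]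
  · linarith [Real.one_le_exp hmean, Real.exp_le_exp.2 (sub_le_self (t * Y ω) hmean)]
  · rw [neg_sub]
    linarith [Real.one_le_exp hvalue, Real.exp_le_exp.2 (sub_le_self (t * ∫ ω', Y ω' ∂μ) hvalue)]

theorem integrable_exp_abs_mul_sub_integral :
    Integrable (fun ω => Real.exp |t * (Y ω - ∫ ω', Y ω' ∂μ)|) μ := by
  have hYm := (integrable_of_integrable_exp_mul_of_nonneg ht hY hexp).aemeasurable
  have hbound : Integrable
      (fun ω => Real.exp (t * Y ω) + Real.exp (t * ∫ ω', Y ω' ∂μ) - 1) μ :=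
    (hexp.add (integrable_const _)).sub (integrable_const _)
  refine hbound.mono' (by fun_prop) (ae_of_all _ fun ω => ?_)
  rw [Real.norm_of_nonneg (Real.exp_pos _).le]
  exact exp_abs_mul_sub_integral_le ht hY ω

theorem integral_exp_abs_mul_sub_integral_le :
    ∫ ω, Real.exp |t * (Y ω - ∫ ω', Y ω' ∂μ)| ∂μ ≤ 2 * mgf Y μ t - 1 := by
  have hYint := integrable_of_integrable_exp_mul_of_nonneg ht hY hexp
  have hadd := hexp.fun_add (integrable_const (Real.exp (t * ∫ ω', Y ω' ∂μ)))
  calc ∫ ω, Real.exp |t * (Y ω - ∫ ω', Y ω' ∂μ)| ∂μ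
      ≤ ∫ ω, (Real.exp (t * Y ω) + Real.exp (t * ∫ ω', Y ω' ∂μ) - 1) ∂μ :=
        integral_mono (integrable_exp_abs_mul_sub_integral ht hY hexp)
          (hadd.sub (integrable_const 1)) fun ω => exp_abs_mul_sub_integral_le ht hY ω
    _ = mgf Y μ t + Real.exp (t * ∫ ω', Y ω' ∂μ) - 1 := by
        rw [integral_sub hadd (integrable_const 1), integral_add hexp (integrable_const _)]
        simp [mgf]
    _ ≤ 2 * mgf Y μ t - 1 := by linarith [exp_mul_integral_le_mgf hYint hexp]

theorem integrable_exp_mul_sub_integral {r : ℝ} (hr : |r| ≤ t) :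
    Integrable (fun ω => Real.exp (r * (Y ω - ∫ ω', Y ω' ∂μ))) μ := by
  have hYm := (integrable_of_integrable_exp_mul_of_nonneg ht hY hexp).aemeasurable
  refine (integrable_exp_abs_mul_sub_integral ht hY hexp).mono' (by fun_prop)
    (ae_of_all _ fun ω => ?_)
  rw [Real.norm_of_nonneg (Real.exp_pos _).le, Real.exp_le_exp, abs_mul, abs_of_pos ht]
  calc r * (Y ω - ∫ ω', Y ω' ∂μ) ≤ |r| * |Y ω - ∫ ω', Y ω' ∂μ| :=
        (le_abs_self _).trans_eq (abs_mul _ _)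
    _ ≤ t * |Y ω - ∫ ω', Y ω' ∂μ| := by gcongr

theorem mgf_sub_integral_le {r : ℝ} (hr : |r| ≤ t) :
    mgf (fun ω => Y ω - ∫ ω', Y ω' ∂μ) μ r ≤
      Real.exp (2 * (mgf Y μ t - 1) * (r / t) ^ 2) := by
  have hθ : |r / t| ≤ 1 := by rwa [abs_div, abs_of_pos ht, div_le_one ht]
  have hYint := integrable_of_integrable_exp_mul_of_nonneg ht hY hexp
  have hcentred : Integrable (fun ω => r * (Y ω - ∫ ω', Y ω' ∂μ)) μ :=
    (hYint.sub (integrable_const _)).const_mul r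
  have habs := integrable_exp_abs_mul_sub_integral ht hY hexp
  have hsq : Integrable
      (fun ω => (r / t) ^ 2 * (Real.exp |t * (Y ω - ∫ ω', Y ω' ∂μ)| - 1)) μ :=
    (habs.sub (integrable_const 1)).const_mul _
  have pointwise (ω : Ω) : Real.exp (r * (Y ω - ∫ ω', Y ω' ∂μ)) ≤
      1 + r * (Y ω - ∫ ω', Y ω' ∂μ) +
        (r / t) ^ 2 * (Real.exp |t * (Y ω - ∫ ω', Y ω' ∂μ)| - 1) := by
    have hle := exp_mul_sub_le_sq_mul hθ (t * (Y ω - ∫ ω', Y ω' ∂μ))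
    rw [← mul_assoc, div_mul_cancel₀ r ht.ne'] at hle
    nlinarith [mul_nonneg (sq_nonneg (r / t)) (abs_nonneg (t * (Y ω - ∫ ω', Y ω' ∂μ)))]
  calc mgf (fun ω => Y ω - ∫ ω', Y ω' ∂μ) μ r
      ≤ ∫ ω, (1 + r * (Y ω - ∫ ω', Y ω' ∂μ) +
          (r / t) ^ 2 * (Real.exp |t * (Y ω - ∫ ω', Y ω' ∂μ)| - 1)) ∂μ :=
        integral_mono (integrable_exp_mul_sub_integral ht hY hexp hr)
          (((integrable_const 1).fun_add hcentred).add hsq) pointwise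
    _ = 1 + (r / t) ^ 2 * (∫ ω, Real.exp |t * (Y ω - ∫ ω', Y ω' ∂μ)| ∂μ - 1) := by
        rw [integral_add ((integrable_const 1).fun_add hcentred) hsq,
          integral_add (integrable_const 1) hcentred, integral_const_mul, integral_const_mul,
          integral_sub hYint (integrable_const _), integral_sub habs (integrable_const 1)]
        simp
    _ ≤ 1 + (r / t) ^ 2 * (2 * mgf Y μ t - 1 - 1) := by
        gcongr
        exact integral_exp_abs_mul_sub_integral_le ht hY hexp
    _ = 2 * (mgf Y μ t - 1) * (r / t) ^ 2 + 1 := by ring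
    _ ≤ Real.exp (2 * (mgf Y μ t - 1) * (r / t) ^ 2) := Real.add_one_le_exp _

end Subexponential

section Deviation

variable {Ω ι : Type*} [MeasurableSpace Ω] {μ : Measure Ω} [IsProbabilityMeasure μ] [Fintype ι]

theorem measureReal_le_sum_le_exp {X : ι → Ω → ℝ} (hind : iIndepFun X μ)
    (hX : ∀ i, Measurable (X i)) {r B : ℝ} (hr : 0 ≤ r)
    (hint : ∀ i, Integrable (fun ω => Real.exp (r * X i ω)) μ)
    (hmgf : ∀ i, mgf (X i) μ r ≤ Real.exp B) (D : ℝ) :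
    μ.real {ω | D ≤ ∑ i, X i ω} ≤ Real.exp (Fintype.card ι * B - r * D) := by
  have hprod : mgf (∑ i, X i) μ r ≤ Real.exp (Fintype.card ι * B) := by
    rw [hind.mgf_sum hX]
    calc ∏ i, mgf (X i) μ r ≤ ∏ _i : ι, Real.exp B :=
          Finset.prod_le_prod (fun i _ => mgf_nonneg) fun i _ => hmgf i
      _ = Real.exp (Fintype.card ι * B) := by
          rw [Finset.prod_const, Finset.card_univ, ← Real.exp_nat_mul]
  have hchernoff := measure_ge_le_exp_mul_mgf D hr
    (hind.integrable_exp_mul_sum hX (s := Finset.univ) fun i _ => hint i)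
  simp only [Finset.sum_apply] at hchernoff
  calc μ.real {ω | D ≤ ∑ i, X i ω} ≤ Real.exp (-r * D) * mgf (∑ i, X i) μ r := hchernoff
    _ ≤ Real.exp (-r * D) * Real.exp (Fintype.card ι * B) := by gcongr
    _ = Real.exp (Fintype.card ι * B - r * D) := by
        rw [← Real.exp_add]
        ring_nf

theorem measureReal_le_abs_sum_le_two_mul_exp {X : ι → Ω → ℝ} (hind : iIndepFun X μ)
    (hX : ∀ i, Measurable (X i)) {r B : ℝ} (hr : 0 ≤ r)
    (hint : ∀ i, ∀ r', |r'| ≤ r → Integrable (fun ω => Real.exp (r' * X i ω)) μ)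
    (hmgf : ∀ i, ∀ r', |r'| ≤ r → mgf (X i) μ r' ≤ Real.exp B) (D : ℝ) :
    μ.real {ω | D ≤ |∑ i, X i ω|} ≤ 2 * Real.exp (Fintype.card ι * B - r * D) := by
  have hr_abs : |r| ≤ r := (abs_of_nonneg hr).le
  have hr_abs_neg : |-r| ≤ r := (abs_neg r).trans_le hr_abs
  have upper := measureReal_le_sum_le_exp hind hX hr (fun i => hint i r hr_abs)
    (fun i => hmgf i r hr_abs) D
  have lower := measureReal_le_sum_le_exp (X := fun i => -X i)
    (hind.comp (fun _ => Neg.neg) fun _ => measurable_neg) (fun i => (hX i).neg) hr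
    (fun i => by simpa using hint i (-r) hr_abs_neg)
    (fun i => mgf_neg.trans_le (hmgf i (-r) hr_abs_neg)) D
  have hunion : {ω | D ≤ |∑ i, X i ω|} ⊆
      {ω | D ≤ ∑ i, X i ω} ∪ {ω | D ≤ ∑ i, (-X i) ω} := fun ω hω => by
    simpa [le_abs] using hω
  linarith [(measureReal_mono hunion (μ := μ)).trans (measureReal_union_le _ _)]

theorem measureReal_bernstein_le {Y : ι → Ω → ℝ} (hind : iIndepFun Y μ)
    (hYm : ∀ i, Measurable (Y i)) (hY : ∀ i, 0 ≤ Y i) {t : ℝ} (ht : 0 < t)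
    (hexp : ∀ i, Integrable (fun ω => Real.exp (t * Y i ω)) μ)
    (hmgf : ∀ i, mgf (Y i) μ t ≤ 3 / 2) {δ : ℝ} (hδ : 0 ≤ δ) :
    μ.real {ω | Fintype.card ι * δ ≤ |∑ i, (Y i ω - ∫ ω', Y i ω' ∂μ)|} ≤
      2 * Real.exp (-(Fintype.card ι * (t * δ) ^ 2 / (2 * (t * δ) + 4))) := by
  set θ : ℝ := t * δ / (t * δ + 2) with hθ
  have : 0 ≤ t * δ := by positivity
  have hθ_nonneg : 0 ≤ θ := by positivity
  have hθ_le : θ ≤ 1 := (div_le_one (by positivity)).2 (by linarith)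
  have hr_le {r : ℝ} (hr : |r| ≤ θ * t) : |r| ≤ t := hr.trans (mul_le_of_le_one_left ht.le hθ_le)
  have hmgf_centred (i : ι) (r : ℝ) (hr : |r| ≤ θ * t) :
      mgf (fun ω => Y i ω - ∫ ω', Y i ω' ∂μ) μ r ≤ Real.exp (θ ^ 2) := by
    refine (mgf_sub_integral_le ht (hY i) (hexp i) (hr_le hr)).trans (Real.exp_le_exp.2 ?_)
    have hsq : (r / t) ^ 2 ≤ θ ^ 2 := by
      rw [sq_le_sq, abs_div, abs_of_pos ht, abs_of_nonneg hθ_nonneg]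
      exact (div_le_iff₀ ht).2 hr
    nlinarith [hmgf i, sq_nonneg (r / t)]
  refine (measureReal_le_abs_sum_le_two_mul_exp
    (hind.comp (fun i y => y - ∫ ω', Y i ω' ∂μ) fun i => by fun_prop)
    (fun i => (hYm i).sub_const _) (mul_nonneg hθ_nonneg ht.le)
    (fun i r hr => integrable_exp_mul_sub_integral ht (hY i) (hexp i) (hr_le hr))
    hmgf_centred _).trans ?_
  gcongr
  have hexponent : θ ^ 2 - θ * (t * δ) ≤ -((t * δ) ^ 2 / (2 * (t * δ) + 4)) := by
    have hx : t * δ + 2 ≠ 0 := by positivity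
    have hgap : -((t * δ) ^ 2 / (2 * (t * δ) + 4)) - (θ ^ 2 - θ * (t * δ)) =
        (t * δ) ^ 3 / (2 * (t * δ + 2) ^ 2) := by
      rw [hθ, show 2 * (t * δ) + 4 = 2 * (t * δ + 2) by ring]
      field_simp
      ring
    have : 0 ≤ (t * δ) ^ 3 / (2 * (t * δ + 2) ^ 2) := by positivity
    linarith
  calc Fintype.card ι * θ ^ 2 - θ * t * (Fintype.card ι * δ)
      = Fintype.card ι * (θ ^ 2 - θ * (t * δ)) := by ring
    _ ≤ Fintype.card ι * -((t * δ) ^ 2 / (2 * (t * δ) + 4)) := by gcongr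
    _ = -(Fintype.card ι * (t * δ) ^ 2 / (2 * (t * δ) + 4)) := by ring

end Deviation

theorem iIndep_iSup_of_pairwise_disjoint {Ω ι κ : Type*} [MeasurableSpace Ω] {μ : Measure Ω}
    {m : ι → MeasurableSpace Ω} (hle : ∀ i, m i ≤ ‹MeasurableSpace Ω›) (h : iIndep m μ)
    {S : κ → Set ι} (hS : Pairwise fun a b => Disjoint (S a) (S b)) :
    iIndep (fun k => ⨆ i ∈ S k, m i) μ := by
  classical
  have := h.isProbabilityMeasure
  rw [iIndep_iff]
  intro s f hf
  induction s using Finset.induction_on with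
  | empty => simp
  | insert a s ha ih =>
    have hdisjoint : Disjoint (S a) (⋃ k ∈ s, S k) := by
      simp only [Set.disjoint_iUnion_right]
      exact fun k hk => hS (ne_of_mem_of_not_mem hk ha).symm
    rw [Finset.set_biInter_insert, Finset.prod_insert ha,
      ← ih fun i hi => hf i (Finset.mem_insert_of_mem hi)]
    refine (Indep_iff _ _ μ).1 (indep_iSup_of_disjoint hle h hdisjoint) _ _
      (hf a (Finset.mem_insert_self a s)) ?_
    refine MeasurableSet.biInter s.countable_toSet fun k hk => ?_
    have hle_union : (⨆ i ∈ S k, m i) ≤ ⨆ i ∈ ⋃ k ∈ s, S k, m i :=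
      biSup_mono fun i hi => Set.mem_biUnion hk hi
    exact hle_union _ (hf k (Finset.mem_insert_of_mem hk))

/-! ### Random signs -/

section RandomSign

variable {Ω : Type*} [MeasurableSpace Ω] {μ : Measure Ω} [IsProbabilityMeasure μ] {F V : Ω → ℝ}

theorem integrable_of_ae_sign (hV : Measurable V) (hsign : ∀ᵐ ω ∂μ, V ω = 1 ∨ V ω = -1) :
    Integrable V μ := by
  refine Integrable.of_bound hV.aestronglyMeasurable 1 ?_
  filter_upwards [hsign] with ω h
  rcases h with h | h <;> simp [h]

omit [IsProbabilityMeasure μ] in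
theorem exp_mul_sign_ae_eq (hsign : ∀ᵐ ω ∂μ, V ω = 1 ∨ V ω = -1) (t : ℝ) :
    (fun ω => Real.exp (t * (F ω * V ω))) =ᵐ[μ] fun ω =>
      (Real.exp (t * F ω) + Real.exp (-t * F ω)) / 2 +
        (Real.exp (t * F ω) - Real.exp (-t * F ω)) / 2 * V ω := by
  filter_upwards [hsign] with ω h
  rcases h with h | h
  · simp only [h, mul_one]
    ring
  · simp only [h, mul_neg, mul_one, neg_mul]
    ring

theorem integrable_exp_sub_mul_sign (hV : Measurable V) (hind : IndepFun F V μ)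
    (hsign : ∀ᵐ ω ∂μ, V ω = 1 ∨ V ω = -1) {t : ℝ}
    (hpos : Integrable (fun ω => Real.exp (t * F ω)) μ)
    (hneg : Integrable (fun ω => Real.exp (-t * F ω)) μ) :
    Integrable (fun ω => (Real.exp (t * F ω) - Real.exp (-t * F ω)) / 2 * V ω) μ :=
  (hind.comp (φ := fun x => (Real.exp (t * x) - Real.exp (-t * x)) / 2) (by fun_prop)
    measurable_id).integrable_mul ((hpos.sub hneg).div_const 2) (integrable_of_ae_sign hV hsign)

theorem mgf_mul_sign (hV : Measurable V) (hind : IndepFun F V μ)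
    (hsign : ∀ᵐ ω ∂μ, V ω = 1 ∨ V ω = -1) {t : ℝ}
    (hpos : Integrable (fun ω => Real.exp (t * F ω)) μ)
    (hneg : Integrable (fun ω => Real.exp (-t * F ω)) μ) :
    mgf (fun ω => F ω * V ω) μ t =
      (1 + ∫ ω, V ω ∂μ) / 2 * mgf F μ t + (1 - ∫ ω, V ω ∂μ) / 2 * mgf F μ (-t) := by
  have hodd : Integrable (fun ω => (Real.exp (t * F ω) - Real.exp (-t * F ω)) / 2) μ :=
    (hpos.sub hneg).div_const 2
  have hind_odd : IndepFun (fun ω => (Real.exp (t * F ω) - Real.exp (-t * F ω)) / 2) V μ :=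
    hind.comp (φ := fun x => (Real.exp (t * x) - Real.exp (-t * x)) / 2) (by fun_prop)
      measurable_id
  rw [mgf, integral_congr_ae (exp_mul_sign_ae_eq hsign t),
    integral_add ((hpos.fun_add hneg).div_const 2)
      (integrable_exp_sub_mul_sign hV hind hsign hpos hneg),
    hind_odd.integral_fun_mul_eq_mul_integral hodd.aestronglyMeasurable hV.aestronglyMeasurable,
    integral_div, integral_div, integral_add hpos hneg, integral_sub hpos hneg]
  simp only [mgf]
  ring

theorem hasSubgaussianMGF_mul_sign {c : ℝ≥0} (hV : Measurable V) (hind : IndepFun F V μ)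
    (hsign : ∀ᵐ ω ∂μ, V ω = 1 ∨ V ω = -1) (hF : HasSubgaussianMGF F c μ) :
    HasSubgaussianMGF (fun ω => F ω * V ω) c μ := by
  refine ⟨fun t => ?_, fun t => ?_⟩
  · have hpos := hF.integrable_exp_mul t
    have hneg := hF.integrable_exp_mul (-t)
    exact (((hpos.add hneg).div_const 2).add
      (integrable_exp_sub_mul_sign hV hind hsign hpos hneg)).congr (exp_mul_sign_ae_eq hsign t).symm
  · have hmean : |∫ ω, V ω ∂μ| ≤ 1 := by
      have hbound : ∀ᵐ ω ∂μ, ‖V ω‖ ≤ 1 := by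
        filter_upwards [hsign] with ω h
        rcases h with h | h <;> simp [h]
      simpa using norm_integral_le_of_norm_le_const hbound
    obtain ⟨hmean_lower, hmean_upper⟩ := abs_le.1 hmean
    have hmgf_neg := hF.mgf_le (-t)
    rw [neg_sq] at hmgf_neg
    rw [mgf_mul_sign hV hind hsign (hF.integrable_exp_mul t) (hF.integrable_exp_mul (-t))]
    calc (1 + ∫ ω, V ω ∂μ) / 2 * mgf F μ t + (1 - ∫ ω, V ω ∂μ) / 2 * mgf F μ (-t)
        ≤ (1 + ∫ ω, V ω ∂μ) / 2 * Real.exp (c * t ^ 2 / 2) +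
            (1 - ∫ ω, V ω ∂μ) / 2 * Real.exp (c * t ^ 2 / 2) :=
          add_le_add (mul_le_mul_of_nonneg_left (hF.mgf_le t) (by linarith))
            (mul_le_mul_of_nonneg_left hmgf_neg (by linarith))
      _ = Real.exp (c * t ^ 2 / 2) := by ring

end RandomSign

section SignedFading

variable {Ω ι : Type*} [MeasurableSpace Ω] {μ : Measure Ω}

/-- One use of a real channel with fading coefficients `F`, random signs `V` and noise `Z`: the
real (or imaginary) part of a use of the complex channel. The numbers `σ` and `ζ` bound the
sub-gaussian variance proxies of fading and noise. -/
structure IsSignedFading (μ : Measure Ω) (F V : ι → Ω → ℝ) (Z : Ω → ℝ) (σ ζ : ℝ≥0) : Prop where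
  indep : iIndepFun (Sum.elim (Sum.elim F V) fun _ : Unit => Z) μ
  measurable_fading : ∀ k, Measurable (F k)
  measurable_sign : ∀ k, Measurable (V k)
  measurable_noise : Measurable Z
  fading_mean : ∀ k, ∫ ω, F k ω ∂μ = 0
  noise_mean : ∫ ω, Z ω ∂μ = 0
  fading_subgaussian : ∀ k, HasSubgaussianMGF (F k) σ μ
  noise_subgaussian : HasSubgaussianMGF Z ζ μ
  ae_sign : ∀ k, ∀ᵐ ω ∂μ, V k ω = 1 ∨ V k ω = -1

/-- The independent summands of the channel output: the noise, and for each transmitter its signed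
fading coefficient weighted with the amplitude `a k`. -/
def signedTerm (F V : ι → Ω → ℝ) (Z : Ω → ℝ) (a : ι → ℝ) : Option ι → Ω → ℝ
  | none => Z
  | some k => fun ω => a k * (F k ω * V k ω)

namespace IsSignedFading

variable {F V : ι → Ω → ℝ} {Z : Ω → ℝ} {σ ζ : ℝ≥0}

theorem indepFun_sign (h : IsSignedFading μ F V Z σ ζ) (k : ι) : IndepFun (F k) (V k) μ :=
  h.indep.indepFun (i := Sum.inl (Sum.inl k)) (j := Sum.inl (Sum.inr k)) (by simp)

theorem iIndepFun_signedTerm (h : IsSignedFading μ F V Z σ ζ) (a : ι → ℝ) :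
    iIndepFun (signedTerm F V Z a) μ := by
  set X : (ι ⊕ ι) ⊕ Unit → Ω → ℝ := Sum.elim (Sum.elim F V) fun _ => Z
  let S : Option ι → Set ((ι ⊕ ι) ⊕ Unit) := fun o =>
    o.elim {Sum.inr ()} fun k => {Sum.inl (Sum.inl k), Sum.inl (Sum.inr k)}
  have hS : Pairwise fun o o' => Disjoint (S o) (S o') := by
    intro o o' hne
    cases o <;> cases o' <;> simp_all [S, eq_comm]
  have hXm : ∀ i, Measurable (X i) := by
    rintro ((k | k) | -)
    exacts [h.measurable_fading k, h.measurable_sign k, h.measurable_noise]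
  have measurable_of_mem {o : Option ι} {i : (ι ⊕ ι) ⊕ Unit} (hi : i ∈ S o) :
      Measurable[⨆ i ∈ S o, MeasurableSpace.comap (X i) inferInstance] (X i) :=
    (comap_measurable (X i)).mono
      (le_biSup (fun i => MeasurableSpace.comap (X i) inferInstance) hi) le_rfl
  refine iIndep_of_iIndep_of_le (iIndep_iSup_of_pairwise_disjoint (fun i => (hXm i).comap_le)
    h.indep.iIndep hS) fun o => Measurable.comap_le ?_
  rcases o with _ | k
  · exact measurable_of_mem (o := none) (i := Sum.inr ()) (by simp [S])
  · exact ((measurable_of_mem (o := some k) (i := Sum.inl (Sum.inl k)) (by simp [S])).mul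
      (measurable_of_mem (o := some k) (i := Sum.inl (Sum.inr k)) (by simp [S]))).const_mul (a k)

theorem hasSubgaussianMGF_signedTerm (h : IsSignedFading μ F V Z σ ζ) (a : ι → ℝ)
    (o : Option ι) : HasSubgaussianMGF (signedTerm F V Z a o)
      (o.elim ζ fun k => (a k ^ 2).toNNReal * σ) μ := by
  have := h.indep.isProbabilityMeasure
  rcases o with _ | k
  · exact h.noise_subgaussian
  · rw [Option.elim_some, Real.toNNReal_of_nonneg (sq_nonneg (a k))]
    exact (hasSubgaussianMGF_mul_sign (h.measurable_sign k) (h.indepFun_sign k) (h.ae_sign k)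
      (h.fading_subgaussian k)).const_mul (a k)

theorem integral_signedTerm (h : IsSignedFading μ F V Z σ ζ) (a : ι → ℝ) (o : Option ι) :
    ∫ ω, signedTerm F V Z a o ω ∂μ = 0 := by
  rcases o with _ | k
  · exact h.noise_mean
  · simp only [signedTerm]
    rw [integral_const_mul, (h.indepFun_sign k).integral_fun_mul_eq_mul_integral
      (h.measurable_fading k).aestronglyMeasurable (h.measurable_sign k).aestronglyMeasurable,
      h.fading_mean, zero_mul, mul_zero]

theorem variance_signedTerm (h : IsSignedFading μ F V Z σ ζ) (a : ι → ℝ) (o : Option ι) :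
    variance (signedTerm F V Z a o) μ =
      o.elim (∫ ω, Z ω ^ 2 ∂μ) fun k => a k ^ 2 * ∫ ω, F k ω ^ 2 ∂μ := by
  rw [variance_of_integral_eq_zero (h.hasSubgaussianMGF_signedTerm a o).aemeasurable
    (h.integral_signedTerm a o)]
  rcases o with _ | k
  · rfl
  · rw [Option.elim_some, ← integral_const_mul]
    refine integral_congr_ae ?_
    filter_upwards [h.ae_sign k] with ω hsign
    have hsq : V k ω ^ 2 = 1 := by rcases hsign with h | h <;> simp [h]
    simp only [signedTerm, mul_pow, hsq, mul_one]

variable [Fintype ι]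

omit [MeasurableSpace Ω] in
theorem sum_signedTerm (F V : ι → Ω → ℝ) (Z : Ω → ℝ) (a : ι → ℝ) (ω : Ω) :
    ∑ o, signedTerm F V Z a o ω = ∑ k, a k * (F k ω * V k ω) + Z ω := by
  rw [Fintype.sum_option, add_comm]
  rfl

theorem hasSubgaussianMGF_output (h : IsSignedFading μ F V Z σ ζ) (a : ι → ℝ) :
    HasSubgaussianMGF (fun ω => ∑ k, a k * (F k ω * V k ω) + Z ω)
      (∑ k, (a k ^ 2).toNNReal * σ + ζ) μ := by
  have hsum := HasSubgaussianMGF.sum_of_iIndepFun (s := Finset.univ) (h.iIndepFun_signedTerm a)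
    fun o _ => h.hasSubgaussianMGF_signedTerm a o
  simp only [sum_signedTerm] at hsum
  rwa [Fintype.sum_option, add_comm] at hsum

theorem integral_output (h : IsSignedFading μ F V Z σ ζ) (a : ι → ℝ) :
    ∫ ω, (∑ k, a k * (F k ω * V k ω) + Z ω) ∂μ = 0 := by
  simp_rw [← sum_signedTerm F V Z a]
  rw [integral_finsetSum _ fun o _ => (h.hasSubgaussianMGF_signedTerm a o).integrable]
  exact Finset.sum_eq_zero fun o _ => h.integral_signedTerm a o

theorem integral_output_sq (h : IsSignedFading μ F V Z σ ζ) (a : ι → ℝ) :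
    ∫ ω, (∑ k, a k * (F k ω * V k ω) + Z ω) ^ 2 ∂μ =
      ∑ k, a k ^ 2 * ∫ ω, F k ω ^ 2 ∂μ + ∫ ω, Z ω ^ 2 ∂μ := by
  have := h.indep.isProbabilityMeasure
  have hvar := IndepFun.variance_sum (s := Finset.univ)
    (fun o _ => (h.hasSubgaussianMGF_signedTerm a o).memLp 2)
    fun o _ o' _ hne => (h.iIndepFun_signedTerm a).indepFun hne
  have hsum : ∑ o, signedTerm F V Z a o = fun ω => ∑ k, a k * (F k ω * V k ω) + Z ω := by
    ext ω
    rw [Finset.sum_apply, sum_signedTerm]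
  rw [hsum, variance_of_integral_eq_zero (h.hasSubgaussianMGF_output a).aemeasurable
    (h.integral_output a)] at hvar
  rw [hvar, Fintype.sum_option, add_comm]
  simp only [h.variance_signedTerm, Option.elim_some, Option.elim_none]

end IsSignedFading

end SignedFading

/-! ### Energy of the channel output -/

section Sources

variable {Ω : Type*} {K : ℕ} (H : ℕ → Fin K → Ω → ℂ) (N : ℕ → Ω → ℂ) (U : ℕ → Fin K → Ω → ℝ)

/-- The σ-algebra generated by the random sources in `S`. -/
abbrev sourceAlgebra (S : Set (ℕ × Source K)) : MeasurableSpace Ω :=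
  ⨆ i ∈ S, MeasurableSpace.comap (sourceVar H N U i) inferInstance

/-- The channel output in use `t` if every transmitter `k` encodes the value `a k`. -/
noncomputable def sumOutput (P : ℝ) (a : Fin K → ℝ) (t : ℕ) (ω : Ω) : ℂ :=
  channelOutput H N t (fun k => sumEncode P (a k) (U t k ω)) ω

theorem sourceAlgebra_mono {S T : Set (ℕ × Source K)} (h : S ⊆ T) :
    sourceAlgebra H N U S ≤ sourceAlgebra H N U T :=
  biSup_mono fun _ hi => h hi

theorem measurable_sourceVar_sourceAlgebra {S : Set (ℕ × Source K)} {i : ℕ × Source K}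
    (hi : i ∈ S) : Measurable[sourceAlgebra H N U S] (sourceVar H N U i) :=
  (comap_measurable (sourceVar H N U i)).mono
    (le_biSup (fun i => MeasurableSpace.comap (sourceVar H N U i) inferInstance) hi) le_rfl

theorem measurable_channelOutput {S : Set (ℕ × Source K)} {t : ℕ} (hS : ∀ i, (t, i) ∈ S)
    {x : Fin K → ℝ → ℂ} (hx : ∀ k, Measurable (x k)) :
    Measurable[sourceAlgebra H N U S]
      fun ω => channelOutput H N t (fun k => x k (U t k ω)) ω := by
  let _ : MeasurableSpace Ω := sourceAlgebra H N U S
  have hsource (i : Source K) : Measurable (sourceVar H N U (t, i)) :=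
    measurable_sourceVar_sourceAlgebra H N U (hS i)
  have hH (k : Fin K) : Measurable (H t k) :=
    measurable_of_re_im (hsource (.fadingRe k)) (hsource (.fadingIm k))
  have hN : Measurable (N t) := measurable_of_re_im (hsource .noiseRe) (hsource .noiseIm)
  have hU (k : Fin K) : Measurable (U t k) := hsource (.sign k)
  exact (Finset.measurable_sum _ fun k _ => (hH k).mul ((hx k).comp (hU k))).add hN

theorem measurable_sumEncode (P s : ℝ) : Measurable (sumEncode P s) := by
  unfold sumEncode
  fun_prop

theorem re_sumOutput (P : ℝ) (a : Fin K → ℝ) (t : ℕ) (ω : Ω) :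
    (sumOutput H N U P a t ω).re =
      ∑ k, √(P * a k) * ((H t k ω).re * U t k ω) + (N t ω).re := by
  simp only [sumOutput, channelOutput, sumEncode, Complex.add_re, Complex.re_sum,
    Complex.re_mul_ofReal, mul_left_comm]

theorem im_sumOutput (P : ℝ) (a : Fin K → ℝ) (t : ℕ) (ω : Ω) :
    (sumOutput H N U P a t ω).im =
      ∑ k, √(P * a k) * ((H t k ω).im * U t k ω) + (N t ω).im := by
  simp only [sumOutput, channelOutput, sumEncode, Complex.add_im, Complex.im_sum,
    Complex.im_mul_ofReal, mul_left_comm]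

end Sources

theorem four_mul_one_div_eight_mul_self {v : ℝ} (hv : 0 < v) : 4 * (1 / (8 * v) * v) = 1 / 2 := by
  field_simp
  norm_num

theorem sq_toNNReal_le_sq (x : ℝ) : (x.toNNReal : ℝ) ^ 2 ≤ x ^ 2 := by
  rw [Real.coe_toNNReal']
  exact sq_le_sq.2 (by simpa using abs_max_le_max_abs_abs (a := x) (b := 0))

theorem sum_sq_sqrt_mul_add_le {K : ℕ} {σF σN P : ℝ} (hP : 0 ≤ P) {a : Fin K → ℝ}
    (ha₀ : ∀ k, 0 ≤ a k) (ha₁ : ∀ k, a k ≤ 1) {v : ℝ≥0} (hv : P * K * σF ^ 2 + σN ^ 2 ≤ v) :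
    ∑ k, (√(P * a k) ^ 2).toNNReal * σF.toNNReal ^ 2 + σN.toNNReal ^ 2 ≤ v := by
  have hterm (k : Fin K) :
      ((√(P * a k) ^ 2).toNNReal : ℝ) * (σF.toNNReal : ℝ) ^ 2 ≤ P * σF ^ 2 := by
    rw [Real.sq_sqrt (mul_nonneg hP (ha₀ k)), Real.coe_toNNReal _ (mul_nonneg hP (ha₀ k))]
    exact mul_le_mul (mul_le_of_le_one_right hP (ha₁ k)) (sq_toNNReal_le_sq σF) (by positivity) hP
  rw [← NNReal.coe_le_coe]
  push_cast
  calc ∑ k, ((√(P * a k) ^ 2).toNNReal : ℝ) * (σF.toNNReal : ℝ) ^ 2 + (σN.toNNReal : ℝ) ^ 2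
      ≤ ∑ _k : Fin K, P * σF ^ 2 + σN ^ 2 :=
        add_le_add (Finset.sum_le_sum fun k _ => hterm k) (sq_toNNReal_le_sq σN)
    _ = P * K * σF ^ 2 + σN ^ 2 := by
        rw [Finset.sum_const, Finset.card_univ, Fintype.card_fin, nsmul_eq_mul]
        ring
    _ ≤ v := hv

theorem integral_norm_sq_eq_add {Ω : Type*} [MeasurableSpace Ω] {μ : Measure Ω} {Z : Ω → ℂ}
    (hre : MemLp (fun ω => (Z ω).re) 2 μ) (him : MemLp (fun ω => (Z ω).im) 2 μ) :
    ∫ ω, ‖Z ω‖ ^ 2 ∂μ = ∫ ω, (Z ω).re ^ 2 ∂μ + ∫ ω, (Z ω).im ^ 2 ∂μ := by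
  simp only [Complex.sq_norm, Complex.normSq_apply, ← pow_two]
  exact integral_add hre.integrable_sq him.integrable_sq

namespace IsFadingChannel

variable {Ω : Type*} [MeasurableSpace Ω] {μ : Measure Ω} {K : ℕ} {H : ℕ → Fin K → Ω → ℂ}
  {N : ℕ → Ω → ℂ} {U : ℕ → Fin K → Ω → ℝ} {σF σN : ℝ}

theorem measurable_sourceVar (hc : IsFadingChannel μ H N U σF σN) (i : ℕ × Source K) :
    Measurable (sourceVar H N U i) := by
  rcases i with ⟨t, k | k | _ | _ | k⟩
  · exact Complex.measurable_re.comp (hc.measurable_fading t k)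
  · exact Complex.measurable_im.comp (hc.measurable_fading t k)
  · exact Complex.measurable_re.comp (hc.measurable_noise t)
  · exact Complex.measurable_im.comp (hc.measurable_noise t)
  · exact hc.measurable_sign t k

theorem sourceAlgebra_le (hc : IsFadingChannel μ H N U σF σN) (S : Set (ℕ × Source K)) :
    sourceAlgebra H N U S ≤ ‹MeasurableSpace Ω› :=
  iSup₂_le fun i _ => (hc.measurable_sourceVar i).comap_le

theorem indep_sourceAlgebra (hc : IsFadingChannel μ H N U σF σN) {S T : Set (ℕ × Source K)}
    (hST : Disjoint S T) : Indep (sourceAlgebra H N U S) (sourceAlgebra H N U T) μ :=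
  indep_iSup_of_disjoint (fun i => (hc.measurable_sourceVar i).comap_le) hc.indep.iIndep hST

theorem iIndep_sourceAlgebra (hc : IsFadingChannel μ H N U σF σN) {κ : Type*}
    {S : κ → Set (ℕ × Source K)} (hS : Pairwise fun i j => Disjoint (S i) (S j)) :
    iIndep (fun k => sourceAlgebra H N U (S k)) μ :=
  iIndep_iSup_of_pairwise_disjoint (fun i => (hc.measurable_sourceVar i).comap_le)
    hc.indep.iIndep hS

theorem iIndepFun_norm_sq_sumOutput (hc : IsFadingChannel μ H N U σF σN) (P : ℝ)
    (a : Fin K → ℝ) : iIndepFun (fun (t : ℕ) ω => ‖sumOutput H N U P a t ω‖ ^ 2) μ := by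
  have hS : Pairwise fun t t' : ℕ =>
      Disjoint {i : ℕ × Source K | i.1 = t} {i : ℕ × Source K | i.1 = t'} :=
    fun t t' hne => Set.disjoint_left.2 fun i hi hi' => hne (hi.symm.trans hi')
  refine iIndep_of_iIndep_of_le (hc.iIndep_sourceAlgebra hS) fun t => Measurable.comap_le ?_
  exact (measurable_norm.pow_const 2).comp
    (measurable_channelOutput H N U (fun i => rfl) fun k => measurable_sumEncode P (a k))

theorem measurable_sumOutput (hc : IsFadingChannel μ H N U σF σN) (P : ℝ) (a : Fin K → ℝ)
    (t : ℕ) : Measurable (sumOutput H N U P a t) :=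
  (measurable_channelOutput H N U (S := Set.univ) (fun _ => Set.mem_univ _)
    fun k => measurable_sumEncode P (a k)).mono (hc.sourceAlgebra_le _) le_rfl

variable [IsProbabilityMeasure μ]

theorem ae_sign (hc : IsFadingChannel μ H N U σF σN) (t : ℕ) (k : Fin K) :
    ∀ᵐ ω ∂μ, U t k ω = 1 ∨ U t k ω = -1 := by
  have hpos : MeasurableSet {ω | U t k ω = 1} := hc.measurable_sign t k (measurableSet_singleton 1)
  have hneg : MeasurableSet {ω | U t k ω = -1} :=
    hc.measurable_sign t k (measurableSet_singleton (-1))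
  have hdisjoint : Disjoint {ω | U t k ω = 1} {ω | U t k ω = -1} :=
    Set.disjoint_left.2 fun ω h h' => by
      rw [Set.mem_ofPred_eq] at h h'
      linarith
  have hunion : μ ({ω | U t k ω = 1} ∪ {ω | U t k ω = -1}) = 1 := by
    rw [measure_union hdisjoint hneg, hc.sign_pos, hc.sign_neg, ENNReal.add_halves]
  exact (prob_compl_eq_zero_iff (hpos.union hneg)).2 hunion

theorem isSignedFading (hc : IsFadingChannel μ H N U σF σN) (t : ℕ) {f : Fin K → Source K}
    {z : Source K}
    (hinj : Function.Injective (Sum.elim (Sum.elim f Source.sign) fun _ : Unit => z))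
    (hf_mean : ∀ k, ∫ ω, sourceVar H N U (t, f k) ω ∂μ = 0)
    (hz_mean : ∫ ω, sourceVar H N U (t, z) ω ∂μ = 0)
    (hf_norm : ∀ k, subGaussianNorm (sourceVar H N U (t, f k)) μ ≤ ENNReal.ofReal σF)
    (hz_norm : subGaussianNorm (sourceVar H N U (t, z)) μ ≤ ENNReal.ofReal σN) :
    IsSignedFading μ (fun k => sourceVar H N U (t, f k)) (U t) (sourceVar H N U (t, z))
      (σF.toNNReal ^ 2) (σN.toNNReal ^ 2) where
  indep := by
    convert hc.indep.precomp (g := fun i => (t, Sum.elim (Sum.elim f Source.sign) (fun _ => z) i))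
      fun i j h => hinj (Prod.ext_iff.1 h).2 using 1
    ext i
    rcases i with (k | k) | k <;> rfl
  measurable_fading k := hc.measurable_sourceVar (t, f k)
  measurable_sign := hc.measurable_sign t
  measurable_noise := hc.measurable_sourceVar (t, z)
  fading_mean := hf_mean
  noise_mean := hz_mean
  fading_subgaussian k := by
    simpa only [hf_mean, sub_zero] using hasSubgaussianMGF_of_subGaussianNorm_le (hf_norm k)
  noise_subgaussian := by
    simpa only [hz_mean, sub_zero] using hasSubgaussianMGF_of_subGaussianNorm_le hz_norm
  ae_sign := hc.ae_sign t

theorem isSignedFading_re (hc : IsFadingChannel μ H N U σF σN) (t : ℕ) :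
    IsSignedFading μ (fun k ω => (H t k ω).re) (U t) (fun ω => (N t ω).re)
      (σF.toNNReal ^ 2) (σN.toNNReal ^ 2) :=
  hc.isSignedFading t (f := .fadingRe) (z := .noiseRe)
    (by rintro ((i | i) | i) ((j | j) | j) <;> simp) (hc.fading_mean_re t) (hc.noise_mean_re t)
    (hc.fading_norm_re t) (hc.noise_norm_re t)

theorem isSignedFading_im (hc : IsFadingChannel μ H N U σF σN) (t : ℕ) :
    IsSignedFading μ (fun k ω => (H t k ω).im) (U t) (fun ω => (N t ω).im)
      (σF.toNNReal ^ 2) (σN.toNNReal ^ 2) :=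
  hc.isSignedFading t (f := .fadingIm) (z := .noiseIm)
    (by rintro ((i | i) | i) ((j | j) | j) <;> simp) (hc.fading_mean_im t) (hc.noise_mean_im t)
    (hc.fading_norm_im t) (hc.noise_norm_im t)

theorem fading_norm_pos (hc : IsFadingChannel μ H N U σF σN) (hK : 0 < K) : 0 < σF := by
  by_contra! hσF
  have hF := (hc.isSignedFading_re 0).fading_subgaussian ⟨0, hK⟩
  rw [Real.toNNReal_of_nonpos hσF, zero_pow two_ne_zero] at hF
  have hvar := hc.fading_var_re 0 ⟨0, hK⟩
  rw [variance_congr hF.ae_eq_zero_of_hasSubgaussianMGF_zero, variance_zero] at hvar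
  exact zero_ne_one hvar

variable {P : ℝ} {a : Fin K → ℝ}

theorem integral_fading_re_sq (hc : IsFadingChannel μ H N U σF σN) (t : ℕ) (k : Fin K) :
    ∫ ω, (H t k ω).re ^ 2 ∂μ = 1 := by
  rw [← hc.fading_var_re t k, variance_of_integral_eq_zero
    (hc.isSignedFading_re t |>.measurable_fading k).aemeasurable (hc.fading_mean_re t k)]

theorem integral_fading_im_sq (hc : IsFadingChannel μ H N U σF σN) (t : ℕ) (k : Fin K) :
    ∫ ω, (H t k ω).im ^ 2 ∂μ = 1 := by
  rw [← hc.fading_var_im t k, variance_of_integral_eq_zero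
    (hc.isSignedFading_im t |>.measurable_fading k).aemeasurable (hc.fading_mean_im t k)]

theorem hasSubgaussianMGF_re_sumOutput (hc : IsFadingChannel μ H N U σF σN) (hP : 0 ≤ P)
    (ha₀ : ∀ k, 0 ≤ a k) (ha₁ : ∀ k, a k ≤ 1) {v : ℝ≥0} (hv : P * K * σF ^ 2 + σN ^ 2 ≤ v)
    (t : ℕ) : HasSubgaussianMGF (fun ω => (sumOutput H N U P a t ω).re) v μ := by
  simp only [re_sumOutput]
  exact hasSubgaussianMGF_mono ((hc.isSignedFading_re t).hasSubgaussianMGF_output _)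
    (sum_sq_sqrt_mul_add_le hP ha₀ ha₁ hv)

theorem hasSubgaussianMGF_im_sumOutput (hc : IsFadingChannel μ H N U σF σN) (hP : 0 ≤ P)
    (ha₀ : ∀ k, 0 ≤ a k) (ha₁ : ∀ k, a k ≤ 1) {v : ℝ≥0} (hv : P * K * σF ^ 2 + σN ^ 2 ≤ v)
    (t : ℕ) : HasSubgaussianMGF (fun ω => (sumOutput H N U P a t ω).im) v μ := by
  simp only [im_sumOutput]
  exact hasSubgaussianMGF_mono ((hc.isSignedFading_im t).hasSubgaussianMGF_output _)
    (sum_sq_sqrt_mul_add_le hP ha₀ ha₁ hv)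

theorem integral_norm_sq_sumOutput (hc : IsFadingChannel μ H N U σF σN) (hP : 0 ≤ P)
    (ha₀ : ∀ k, 0 ≤ a k) (t : ℕ) :
    ∫ ω, ‖sumOutput H N U P a t ω‖ ^ 2 ∂μ = 2 * P * ∑ k, a k + ∫ ω, ‖N t ω‖ ^ 2 ∂μ := by
  have hre := hc.isSignedFading_re t
  have him := hc.isSignedFading_im t
  have hre_output := hre.hasSubgaussianMGF_output fun k => √(P * a k)
  have him_output := him.hasSubgaussianMGF_output fun k => √(P * a k)
  have hre_sq := hre.integral_output_sq fun k => √(P * a k)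
  have him_sq := him.integral_output_sq fun k => √(P * a k)
  simp only [← re_sumOutput, ← im_sumOutput, hc.integral_fading_re_sq, hc.integral_fading_im_sq,
    Real.sq_sqrt (mul_nonneg hP (ha₀ _)), mul_one, ← Finset.mul_sum]
    at hre_output him_output hre_sq him_sq
  rw [integral_norm_sq_eq_add (hre_output.memLp 2) (him_output.memLp 2), hre_sq, him_sq,
    integral_norm_sq_eq_add (hre.noise_subgaussian.memLp 2) (him.noise_subgaussian.memLp 2)]
  ring

theorem integrable_exp_mul_norm_sq_sumOutput (hc : IsFadingChannel μ H N U σF σN) (hP : 0 ≤ P)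
    (ha₀ : ∀ k, 0 ≤ a k) (ha₁ : ∀ k, a k ≤ 1) {v : ℝ≥0} (hv₀ : 0 < v)
    (hv : P * K * σF ^ 2 + σN ^ 2 ≤ v) (t : ℕ) :
    Integrable (fun ω => Real.exp (1 / (8 * v) * ‖sumOutput H N U P a t ω‖ ^ 2)) μ := by
  refine integrable_exp_mul_normSq (hc.hasSubgaussianMGF_re_sumOutput hP ha₀ ha₁ hv t)
    (hc.hasSubgaussianMGF_im_sumOutput hP ha₀ ha₁ hv t) (by positivity) ?_
  rw [four_mul_one_div_eight_mul_self (NNReal.coe_pos.2 hv₀)]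
  norm_num

theorem mgf_norm_sq_sumOutput_le (hc : IsFadingChannel μ H N U σF σN) (hP : 0 ≤ P)
    (ha₀ : ∀ k, 0 ≤ a k) (ha₁ : ∀ k, a k ≤ 1) {v : ℝ≥0} (hv₀ : 0 < v)
    (hv : P * K * σF ^ 2 + σN ^ 2 ≤ v) (t : ℕ) :
    mgf (fun ω => ‖sumOutput H N U P a t ω‖ ^ 2) μ (1 / (8 * v)) ≤ 3 / 2 := by
  have htv := four_mul_one_div_eight_mul_self (NNReal.coe_pos.2 hv₀)
  have hsqrt : 2 / 3 ≤ √(1 / 2) := Real.le_sqrt_of_sq_le (by norm_num)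
  have hmgf := mgf_normSq_le (t := 1 / (8 * (v : ℝ)))
    (hc.hasSubgaussianMGF_re_sumOutput hP ha₀ ha₁ hv t)
    (hc.hasSubgaussianMGF_im_sumOutput hP ha₀ ha₁ hv t) (by positivity) (by rw [htv]; norm_num)
  calc mgf (fun ω => ‖sumOutput H N U P a t ω‖ ^ 2) μ (1 / (8 * v))
      ≤ (√(1 - 4 * (1 / (8 * v) * v)))⁻¹ := hmgf
    _ = (√(1 / 2))⁻¹ := by rw [htv, sub_half]
    _ ≤ (2 / 3)⁻¹ := inv_anti₀ (by norm_num) hsqrt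
    _ = 3 / 2 := inv_div 2 3

end IsFadingChannel

theorem two_mul_exp_le_sumErrorBound {M K : ℕ} {σF σN P ε w : ℝ} (hσF : 0 ≤ σF) (hσN : 0 ≤ σN)
    (hP : 0 < P) (hε : 0 < ε) (hw₀ : 0 < w) (hw : w = K * σF ^ 2 + σN ^ 2 / P) :
    2 * Real.exp (-(M * ε ^ 2 / (8 * w * ε + 64 * w ^ 2))) ≤ sumErrorBound M K σF σN P ε := by
  unfold sumErrorBound
  set L : ℝ := 3 * σF ^ 2 * K + 4 * σN * σF * √K / √P + 2 * σN ^ 2 / P with hL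
  have hwL : 2 * w ≤ L := by
    have hfading : 0 ≤ σF ^ 2 * K := by positivity
    have hcross : 0 ≤ 4 * σN * σF * √K / √P := by positivity
    rw [hw, hL, mul_div_assoc 2 (σN ^ 2)]
    linarith
  have hdenom : 8 * w * ε + 64 * w ^ 2 ≤ 4 * L * ε + 16 * L ^ 2 := by
    have hlinear : 2 * w * ε ≤ L * ε := by gcongr
    have hsquare : (2 * w) ^ 2 ≤ L ^ 2 := by gcongr
    linarith
  calc 2 * Real.exp (-(M * ε ^ 2 / (8 * w * ε + 64 * w ^ 2)))
      ≤ 2 * Real.exp (-(M * ε ^ 2 / (4 * L * ε + 16 * L ^ 2))) := by gcongr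
    _ ≤ _ := le_add_of_nonneg_left (by positivity)

theorem sumDecode_sub_eq_div {M : ℕ} (hM : 0 < M) {P : ℝ} (hP : 0 < P) {ν e : Fin M → ℝ}
    {S : ℝ} (he : ∀ i, e i = 2 * P * S + ν i) (y : Fin M → ℂ) :
    sumDecode P ν y - S = (∑ i, (‖y i‖ ^ 2 - e i)) / (2 * M * P) := by
  have hM' : (M : ℝ) ≠ 0 := by positivity
  simp only [sumDecode, he, Finset.sum_sub_distrib, Finset.sum_add_distrib, Finset.sum_const,
    Finset.card_univ, Fintype.card_fin, nsmul_eq_mul]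
  field_simp
  ring

theorem IsFadingChannel.measureReal_sumDecode_error_le {Ω : Type*} [MeasurableSpace Ω]
    {μ : Measure Ω} [IsProbabilityMeasure μ] {K : ℕ} {H : ℕ → Fin K → Ω → ℂ} {N : ℕ → Ω → ℂ}
    {U : ℕ → Fin K → Ω → ℝ} {σF σN : ℝ} (hc : IsFadingChannel μ H N U σF σN) (hσN : 0 ≤ σN)
    (hK : 0 < K) {P : ℝ} (hP : 0 < P) {a : Fin K → ℝ} (ha₀ : ∀ k, 0 ≤ a k)
    (ha₁ : ∀ k, a k ≤ 1) {M : ℕ} (hM : 0 < M) {τ : Fin M → ℕ} (hτ : Function.Injective τ) {ε : ℝ}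
    (hε : 0 < ε) :
    μ.real {ω | ε ≤ |sumDecode P (fun i => ∫ ω', ‖N (τ i) ω'‖ ^ 2 ∂μ)
      (fun i => sumOutput H N U P a (τ i) ω) - ∑ k, a k|} ≤ sumErrorBound M K σF σN P ε := by
  have hσF : 0 < σF := hc.fading_norm_pos hK
  obtain ⟨w, hw⟩ : ∃ w : ℝ, w = K * σF ^ 2 + σN ^ 2 / P := ⟨_, rfl⟩
  have hw₀ : 0 < w := by rw [hw]; positivity
  lift w to ℝ≥0 using hw₀.le
  lift P to ℝ≥0 using hP.le
  have hv₀ : 0 < P * w := mul_pos (NNReal.coe_pos.1 hP) (NNReal.coe_pos.1 hw₀)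
  have hv : P * K * σF ^ 2 + σN ^ 2 ≤ ((P * w : ℝ≥0) : ℝ) := by
    rw [NNReal.coe_mul, hw, mul_add, mul_div_cancel₀ _ hP.ne', mul_assoc]
  have hbernstein := measureReal_bernstein_le (δ := 2 * P * ε)
    ((hc.iIndepFun_norm_sq_sumOutput P a).precomp hτ)
    (fun i => (hc.measurable_sumOutput P a (τ i)).norm.pow_const 2) (fun i ω => sq_nonneg _)
    (by positivity)
    (fun i => hc.integrable_exp_mul_norm_sq_sumOutput hP.le ha₀ ha₁ hv₀ hv (τ i))
    (fun i => hc.mgf_norm_sq_sumOutput_le hP.le ha₀ ha₁ hv₀ hv (τ i)) (by positivity)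
  have hexponent : M * (1 / (8 * (P * w)) * (2 * P * ε)) ^ 2 /
      (2 * (1 / (8 * (P * w)) * (2 * P * ε)) + 4) = M * ε ^ 2 / (8 * w * ε + 64 * w ^ 2) := by
    field_simp
    ring
  rw [Fintype.card_fin, NNReal.coe_mul, hexponent] at hbernstein
  refine le_trans (le_of_eq ?_)
    (hbernstein.trans (two_mul_exp_le_sumErrorBound hσF.le hσN hP hε hw₀ hw))
  have hpos : (0 : ℝ) < 2 * M * P := by positivity
  congr 1
  ext ω
  simp only [Set.mem_ofPred_eq]
  rw [sumDecode_sub_eq_div hM hP fun i => hc.integral_norm_sq_sumOutput hP.le ha₀ (τ i), abs_div,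
    abs_of_pos hpos, le_div_iff₀' hpos]
  ring_nf

/-! ### Adaptive protocols -/

section Adaptive

variable {Ω β : Type*} [Countable β] {f : Ω → β}

theorem measurableSet_setOf_mem_apply [MeasurableSpace Ω]
    (hf : ∀ b, MeasurableSet {ω | f ω = b}) {B : β → Set Ω}
    (hB : ∀ ω, MeasurableSet (B (f ω))) : MeasurableSet {ω | ω ∈ B (f ω)} := by
  have hunion : {ω | ω ∈ B (f ω)} = ⋃ b ∈ Set.range f, {ω | f ω = b} ∩ B b := by
    ext ω
    simp only [Set.biUnion_range, Set.mem_iUnion]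
    exact ⟨fun h => ⟨ω, rfl, h⟩, fun ⟨_, hω, h⟩ => by rwa [← hω] at h⟩
  rw [hunion]
  refine MeasurableSet.biUnion (Set.to_countable _) ?_
  rintro _ ⟨ω, rfl⟩
  exact (hf _).inter (hB ω)

theorem mul_measure_le_measure_inter_mem_apply {m₁ m₂ mΩ : MeasurableSpace Ω} {μ : Measure Ω}
    (h₁ : m₁ ≤ mΩ) (h₂ : m₂ ≤ mΩ) (hind : Indep m₁ m₂ μ) {A : Set Ω}
    (hA : MeasurableSet[m₁] A) (hf : ∀ b, MeasurableSet[m₁] {ω | f ω = b}) {B : β → Set Ω}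
    (hB : ∀ b, MeasurableSet[m₂] (B b)) {c : ℝ≥0∞} (hc : ∀ b, c ≤ μ (B b)) :
    c * μ A ≤ μ (A ∩ {ω | ω ∈ B (f ω)}) := by
  have hAf (b : β) : MeasurableSet[m₁] (A ∩ {ω | f ω = b}) := MeasurableSet.inter hA (hf b)
  have hpartition : A = ⋃ b, A ∩ {ω | f ω = b} := by
    ext ω
    simp
  have hpartition_inter : A ∩ {ω | ω ∈ B (f ω)} = ⋃ b, (A ∩ {ω | f ω = b}) ∩ B b := by
    ext ω
    simp [and_assoc]
  have hdisjoint : Pairwise fun b b' => Disjoint (A ∩ {ω | f ω = b}) (A ∩ {ω | f ω = b'}) :=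
    fun b b' hne => Set.disjoint_left.2 fun ω hω hω' => hne (hω.2.symm.trans hω'.2)
  calc c * μ A = ∑' b, c * μ (A ∩ {ω | f ω = b}) := by
        rw [ENNReal.tsum_mul_left, ← measure_iUnion hdisjoint fun b => h₁ _ (hAf b), ← hpartition]
    _ ≤ ∑' b, μ ((A ∩ {ω | f ω = b}) ∩ B b) := by
        refine ENNReal.tsum_le_tsum fun b => ?_
        rw [(Indep_iff _ _ μ).1 hind _ _ (hAf b) (hB b), mul_comm]
        gcongr
        exact hc b
    _ = μ (A ∩ {ω | ω ∈ B (f ω)}) := by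
        rw [hpartition_inter, measure_iUnion
          (fun b b' hne => (hdisjoint hne).mono Set.inter_subset_left Set.inter_subset_left)
          fun b => (h₁ _ (hAf b)).inter (h₂ _ (hB b))]

end Adaptive

namespace StarProtocol

variable {K : ℕ} {α Msg Ω : Type*} (p : StarProtocol K α Msg) (s : Fin K → α)
  (H : ℕ → Fin K → Ω → ℂ) (N : ℕ → Ω → ℂ) (U : ℕ → Fin K → Ω → ℝ)

/-- The multicast that follows the multicasts `h` if the protocol has not ended. -/
def reply (h : List Msg) (ω : Ω) : Msg :=
  p.multicast h fun i =>
    channelOutput H N (p.uses * h.length + i) (fun k => p.transmitted s U h i k ω) ω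

theorem transcript_succ (ω : Ω) (t : ℕ) :
    p.transcript s H N U ω (t + 1) =
      if p.halted (p.transcript s H N U ω t) then p.transcript s H N U ω t
      else p.transcript s H N U ω t ++ [p.reply s H N U (p.transcript s H N U ω t) ω] :=
  rfl

theorem length_transcript_le (ω : Ω) (t : ℕ) : (p.transcript s H N U ω t).length ≤ t := by
  induction t with
  | zero => rfl
  | succ t ih =>
    rw [transcript_succ]
    split_ifs
    · exact ih.trans t.le_succ
    · simpa using ih

variable [MeasurableSpace Msg] {p s}

theorem measurable_reply {h : List Msg} (hsymbol : ∀ k i, Measurable (p.symbol k (s k) h i))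
    (hmulticast : Measurable (p.multicast h)) {S : Set (ℕ × Source K)}
    (hS : ∀ (i : Fin p.uses) (c : Source K), (p.uses * h.length + i, c) ∈ S) :
    Measurable[sourceAlgebra H N U S] (p.reply s H N U h) :=
  hmulticast.comp <| @measurable_pi_lambda _ _ _ (sourceAlgebra H N U S) _ _ fun i =>
    measurable_channelOutput H N U (hS i) fun k => hsymbol k i

variable [MeasurableSingletonClass Msg] [Countable Msg]
  (hsymbol : ∀ k h i, Measurable (p.symbol k (s k) h i))
  (hmulticast : ∀ h, Measurable (p.multicast h))

include hsymbol hmulticast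

theorem measurableSet_transcript_eq (t : ℕ) (h : List Msg) :
    MeasurableSet[sourceAlgebra H N U (Prod.fst ⁻¹' Set.Iio (p.uses * t))]
      {ω | p.transcript s H N U ω t = h} := by
  induction t generalizing h with
  | zero => exact @MeasurableSet.const _ (sourceAlgebra H N U _) ([] = h)
  | succ t ih =>
    have hpast : (Prod.fst ⁻¹' Set.Iio (p.uses * t) : Set (ℕ × Source K)) ⊆
        Prod.fst ⁻¹' Set.Iio (p.uses * (t + 1)) :=
      Set.preimage_mono (Set.Iio_subset_Iio (Nat.mul_le_mul_left _ t.le_succ))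
    refine @measurableSet_setOf_mem_apply _ _ _ _ (sourceAlgebra H N U _)
      (fun g => sourceAlgebra_mono H N U hpast _ (ih g))
      (fun g => {ω | (if p.halted g then g else g ++ [p.reply s H N U g ω]) = h}) fun ω => ?_
    split_ifs
    · exact @MeasurableSet.const _ (sourceAlgebra H N U _) (p.transcript s H N U ω t = h)
    · have happend : MeasurableSet {c : Msg | p.transcript s H N U ω t ++ [c] = h} :=
        Set.Subsingleton.measurableSet fun c hc c' hc' => by
          simpa using List.append_cancel_left (hc.trans hc'.symm)
      refine measurable_reply H N U (fun k i => hsymbol k _ i) (hmulticast _)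
        (fun i _ => ?_) happend
      calc p.uses * (p.transcript s H N U ω t).length + i
          < p.uses * ((p.transcript s H N U ω t).length + 1) := by
            rw [mul_add_one]
            exact Nat.add_lt_add_left i.2 _
        _ ≤ p.uses * (t + 1) :=
            Nat.mul_le_mul_left _ (Nat.succ_le_succ (p.length_transcript_le s H N U ω t))

theorem measurableSet_forall_lt_mem_transcript {G : ℕ → List Msg → Set Ω}
    (hG : ∀ j h, MeasurableSet[sourceAlgebra H N U
      (Prod.fst ⁻¹' Set.Ico (p.uses * j) (p.uses * (j + 1)))] (G j h)) (J : ℕ) :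
    MeasurableSet[sourceAlgebra H N U (Prod.fst ⁻¹' Set.Iio (p.uses * J))]
      {ω | ∀ j < J, ω ∈ G j (p.transcript s H N U ω j)} := by
  simp only [Set.ofPred_forall]
  refine @MeasurableSet.biInter _ _ (sourceAlgebra H N U _) _ _ (Set.to_countable (Set.Iio J))
    fun j hj => ?_
  have hj' : p.uses * (j + 1) ≤ p.uses * J := Nat.mul_le_mul_left _ hj
  exact @measurableSet_setOf_mem_apply _ _ _ _ (sourceAlgebra H N U _)
    (fun h => sourceAlgebra_mono H N U (Set.preimage_mono (Set.Iio_subset_Iio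
      ((Nat.mul_le_mul_left _ j.le_succ).trans hj'))) _
      (measurableSet_transcript_eq H N U hsymbol hmulticast j h)) (G j)
    fun ω => sourceAlgebra_mono H N U
      (Set.preimage_mono fun t ht => ht.2.trans_le hj') _ (hG j _)

theorem pow_le_measure_forall_lt_mem_transcript [MeasurableSpace Ω] {μ : Measure Ω}
    [IsProbabilityMeasure μ] {σF σN : ℝ} {H N U} (hc : IsFadingChannel μ H N U σF σN)
    {G : ℕ → List Msg → Set Ω}
    (hG : ∀ j h, MeasurableSet[sourceAlgebra H N U
      (Prod.fst ⁻¹' Set.Ico (p.uses * j) (p.uses * (j + 1)))] (G j h))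
    {c : ℝ≥0∞} (hcG : ∀ j h, c ≤ μ (G j h)) (J : ℕ) :
    c ^ J ≤ μ {ω | ∀ j < J, ω ∈ G j (p.transcript s H N U ω j)} := by
  induction J with
  | zero => simp
  | succ J ih =>
    have hdisjoint : Disjoint (Prod.fst ⁻¹' Set.Iio (p.uses * J) : Set (ℕ × Source K))
        (Prod.fst ⁻¹' Set.Ico (p.uses * J) (p.uses * (J + 1))) :=
      Disjoint.preimage _ (Set.disjoint_left.2 fun t ht ht' => ht.not_ge ht'.1)
    calc c ^ (J + 1) ≤ c * μ {ω | ∀ j < J, ω ∈ G j (p.transcript s H N U ω j)} := by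
          rw [pow_succ']
          gcongr
      _ ≤ μ ({ω | ∀ j < J, ω ∈ G j (p.transcript s H N U ω j)} ∩
            {ω | ω ∈ G J (p.transcript s H N U ω J)}) :=
          mul_measure_le_measure_inter_mem_apply (hc.sourceAlgebra_le _) (hc.sourceAlgebra_le _)
            (hc.indep_sourceAlgebra hdisjoint)
            (measurableSet_forall_lt_mem_transcript H N U hsymbol hmulticast hG J)
            (measurableSet_transcript_eq H N U hsymbol hmulticast J) (hG J) (hcG J)
      _ = μ {ω | ∀ j < J + 1, ω ∈ G j (p.transcript s H N U ω j)} := by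
          simp only [Nat.forall_lt_succ_right]
          rfl

end StarProtocol

/-! ### Accuracy of the estimates -/

instance : Countable Message :=
  Function.Injective.countable
    (f := fun | .append c => (Sum.inl c : Bool ⊕ Bool) | .finish w => Sum.inr w) <| by
      rintro (c | w) (c' | w') h <;> simp_all

instance : MeasurableSpace Message := ⊤

theorem measurable_react (m : ℕ) : Measurable (react m) :=
  .ite (measurableSet_le measurable_const (measurable_pi_apply 0)) measurable_const <|
    .ite (measurableSet_lt (measurable_pi_apply 1) measurable_const) measurable_const <|
      .ite (measurableSet_le measurable_const (measurable_pi_apply 2)) measurable_const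
        measurable_const

theorem measurable_sumDecode (P : ℝ) {M : ℕ} (ν : Fin M → ℝ) : Measurable (sumDecode P ν) := by
  unfold sumDecode
  fun_prop

/-- The channel use that is number `i` among those for question `q` in step `j`. -/
def useIndex (M j : ℕ) (q : Fin 3) (i : Fin M) : ℕ :=
  3 * M * j + (finProdFinEquiv (q, i) : Fin (3 * M))

theorem le_useIndex {M : ℕ} (j : ℕ) (q : Fin 3) (i : Fin M) : 3 * M * j ≤ useIndex M j q i :=
  Nat.le_add_right _ _

theorem useIndex_lt {M : ℕ} (j : ℕ) (q : Fin 3) (i : Fin M) :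
    useIndex M j q i < 3 * M * (j + 1) := by
  rw [mul_add_one]
  exact Nat.add_lt_add_left (finProdFinEquiv (q, i)).2 _

theorem useIndex_inj {M j : ℕ} {q q' : Fin 3} {i i' : Fin M} :
    useIndex M j q i = useIndex M j q' i' ↔ q = q' ∧ i = i' := by
  simp only [useIndex, Nat.add_left_cancel_iff, Fin.val_inj, finProdFinEquiv.injective.eq_iff,
    Prod.mk.injEq]

section Estimates

variable {Ω : Type*} {K : ℕ}

open Classical in
/-- The indicator function of the agents with sequences `b` which answer question `q` about the
word `x` in the affirmative. -/
noncomputable def queryIndicator (b : Fin K → Lex (ℕ → Bool)) (x : List Bool) (q : Fin 3)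
    (k : Fin K) : ℝ :=
  if Query x (b k) q then 1 else 0

theorem queryIndicator_mem_Icc (b : Fin K → Lex (ℕ → Bool)) (x : List Bool) (q : Fin 3)
    (k : Fin K) : queryIndicator b x q k ∈ Set.Icc 0 1 := by
  unfold queryIndicator
  split_ifs <;> simp

theorem sum_queryIndicator (b : Fin K → Lex (ℕ → Bool)) (x : List Bool) (q : Fin 3) :
    ∑ k, queryIndicator b x q k = ({k | Query x (b k) q}.ncard : ℝ) := by
  classical
  simp [queryIndicator, Set.ncard_eq_toFinset_card']

variable (M : ℕ) (P : ℝ) (ν : ℕ → ℝ) (b : Fin K → Lex (ℕ → Bool))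
  (H : ℕ → Fin K → Ω → ℂ) (N : ℕ → Ω → ℂ) (U : ℕ → Fin K → Ω → ℝ)

/-- The coordinator's estimate, from the channel uses of step `j`, of the number of agents that
answer question `q` about the word `x` in the affirmative. -/
noncomputable def estimate (j : ℕ) (x : List Bool) (q : Fin 3) (ω : Ω) : ℝ :=
  sumDecode P (fun i => ν (useIndex M j q i))
    fun i => sumOutput H N U P (queryIndicator b x q) (useIndex M j q i) ω

/-- The event that all three estimates about the word `x` in step `j` have an error below `ε`. -/
def accurate (ε : ℝ) (j : ℕ) (x : List Bool) : Set Ω :=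
  {ω | ∀ q, |estimate M P ν b H N U j x q ω - {k | Query x (b k) q}.ncard| < ε}

theorem accurate_eq_iInter (ε : ℝ) (j : ℕ) (x : List Bool) :
    accurate M P ν b H N U ε j x =
      ⋂ q, {ω | |estimate M P ν b H N U j x q ω - {k | Query x (b k) q}.ncard| < ε} :=
  Set.ofPred_forall _

theorem measurable_estimate {S : Set (ℕ × Source K)} {j : ℕ} {q : Fin 3}
    (hS : ∀ i c, (useIndex M j q i, c) ∈ S) (x : List Bool) :
    Measurable[sourceAlgebra H N U S] (estimate M P ν b H N U j x q) :=
  (measurable_sumDecode P _).comp <|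
    @measurable_pi_lambda _ _ _ (sourceAlgebra H N U S) _ _ fun i =>
      measurable_channelOutput H N U (hS i) fun _ => measurable_sumEncode P _

theorem measurableSet_estimate_error_lt {S : Set (ℕ × Source K)} {j : ℕ} {q : Fin 3}
    (hS : ∀ i c, (useIndex M j q i, c) ∈ S) (ε : ℝ) (x : List Bool) :
    MeasurableSet[sourceAlgebra H N U S]
      {ω | |estimate M P ν b H N U j x q ω - {k | Query x (b k) q}.ncard| < ε} :=
  measurable_estimate M P ν b H N U hS x <|
    measurableSet_lt (f := fun e : ℝ => |e - {k | Query x (b k) q}.ncard|) (by fun_prop)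
      measurable_const

theorem measurableSet_accurate {S : Set (ℕ × Source K)} {j : ℕ}
    (hS : ∀ q i c, (useIndex M j q i, c) ∈ S) (ε : ℝ) (x : List Bool) :
    MeasurableSet[sourceAlgebra H N U S] (accurate M P ν b H N U ε j x) := by
  rw [accurate_eq_iInter]
  exact MeasurableSet.iInter fun q =>
    measurableSet_estimate_error_lt M P ν b H N U (hS q) ε x

variable {M P b H N U} [MeasurableSpace Ω] {μ : Measure Ω} [IsProbabilityMeasure μ] {σF σN : ℝ}

theorem IsFadingChannel.le_measure_estimate_error_lt (hc : IsFadingChannel μ H N U σF σN)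
    (hσN : 0 ≤ σN) (hK : 0 < K) (hP : 0 < P) (hM : 0 < M) {ε : ℝ} (hε : 0 < ε) (j : ℕ)
    (x : List Bool) (q : Fin 3) :
    ENNReal.ofReal (1 - sumErrorBound M K σF σN P ε) ≤
      μ {ω | |estimate M P (fun t => ∫ ω, ‖N t ω‖ ^ 2 ∂μ) b H N U j x q ω -
        {k | Query x (b k) q}.ncard| < ε} := by
  have herror := hc.measureReal_sumDecode_error_le hσN hK hP
    (fun k => (queryIndicator_mem_Icc b x q k).1) (fun k => (queryIndicator_mem_Icc b x q k).2)
    hM (τ := useIndex M j q) (fun i i' h => (useIndex_inj.1 h).2) hε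
  have hmeas := hc.sourceAlgebra_le _ _ (measurableSet_estimate_error_lt M P
    (fun t => ∫ ω, ‖N t ω‖ ^ 2 ∂μ) b H N U (S := Set.univ) (j := j) (q := q)
    (fun _ _ => Set.mem_univ _) ε x)
  rw [sum_queryIndicator] at herror
  refine ENNReal.ofReal_le_of_le_toReal ?_
  calc 1 - sumErrorBound M K σF σN P ε ≤ 1 - μ.real _ := sub_le_sub_left herror 1
    _ = _ := by
        rw [← compl_compl {ω | _ < ε}, ← measureReal_def, probReal_compl_eq_one_sub hmeas.compl]
        simp only [Set.compl_ofPred, not_lt]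
        rfl

theorem IsFadingChannel.le_measure_accurate (hc : IsFadingChannel μ H N U σF σN)
    (hσN : 0 ≤ σN) (hK : 0 < K) (hP : 0 < P) (hM : 0 < M) {ε : ℝ} (hε : 0 < ε) (j : ℕ)
    (x : List Bool) :
    ENNReal.ofReal (1 - sumErrorBound M K σF σN P ε) ^ 3 ≤
      μ (accurate M P (fun t => ∫ ω, ‖N t ω‖ ^ 2 ∂μ) b H N U ε j x) := by
  let S (q : Fin 3) : Set (ℕ × Source K) := {c | ∃ i, c.1 = useIndex M j q i}
  have hS : Pairwise fun q q' => Disjoint (S q) (S q') := fun q q' hne =>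
    Set.disjoint_left.2 fun c ⟨i, hi⟩ ⟨i', hi'⟩ => hne (useIndex_inj.1 (hi.symm.trans hi')).1
  have hmeas (q : Fin 3) := measurableSet_estimate_error_lt M P
    (fun t => ∫ ω, ‖N t ω‖ ^ 2 ∂μ) b H N U (S := S q) (fun i _ => ⟨i, rfl⟩) ε x
  rw [accurate_eq_iInter, (hc.iIndep_sourceAlgebra hS).meas_iInter hmeas]
  calc ENNReal.ofReal (1 - sumErrorBound M K σF σN P ε) ^ 3
      = ∏ _q : Fin 3, ENNReal.ofReal (1 - sumErrorBound M K σF σN P ε) := by simp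
    _ ≤ _ := Finset.prod_le_prod' fun q _ =>
        hc.le_measure_estimate_error_lt hσN hK hP hM hε j x q

end Estimates

theorem norm_sumEncode_sq_le {P : ℝ} (hP : 0 ≤ P) {a u : ℝ} (ha : a ∈ Set.Icc 0 1)
    (hu : u ^ 2 = 1) : ‖sumEncode P a u‖ ^ 2 ≤ P := by
  rw [sumEncode, Complex.norm_real, Real.norm_eq_abs, sq_abs, mul_pow, hu, mul_one,
    Real.sq_sqrt (mul_nonneg hP ha.1)]
  exact mul_le_of_le_one_right hP ha.2

namespace scalableMax

variable {Ω α : Type*} {K M m : ℕ} {φ : α → Lex (ℕ → Bool)} {P : ℝ} {ν : ℕ → ℝ} {s : Fin K → α}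
  {H : ℕ → Fin K → Ω → ℂ} {N : ℕ → Ω → ℂ} {U : ℕ → Fin K → Ω → ℝ}

theorem measurable_symbol (k : Fin K) (a : α) (h : List Message) (i : Fin (3 * M)) :
    Measurable ((scalableMax K M m φ P ν).symbol k a h i) :=
  measurable_sumEncode P _

theorem measurable_multicast (h : List Message) :
    Measurable ((scalableMax K M m φ P ν).multicast h) := by
  change Measurable fun y : Fin (3 * M) → ℂ => react m fun q =>
    sumDecode P (fun i => ν (useIndex M h.length q i)) fun i => y (finProdFinEquiv (q, i))
  exact (measurable_react m).comp <| measurable_pi_lambda _ fun q =>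
    (measurable_sumDecode P fun i => ν (useIndex M h.length q i)).comp <|
      measurable_pi_lambda _ fun i => measurable_pi_apply (finProdFinEquiv (q, i))

theorem reply_eq_react_estimate (h : List Message) (ω : Ω) :
    (scalableMax K M m φ P ν).reply s H N U h ω =
      react m fun q =>
        estimate M P ν (fun k => φ (s k)) H N U h.length (currentWord h) q ω := by
  change react m (fun q => sumDecode P (fun i => ν (useIndex M h.length q i)) fun i =>
    channelOutput H N (useIndex M h.length q i) (fun k => (scalableMax K M m φ P ν).transmitted
      s U h (finProdFinEquiv (q, i) : Fin (3 * M)) k ω) ω) = _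
  refine congrArg (react m) (funext fun q => congrArg (sumDecode P _) (funext fun i => ?_))
  refine congrArg (fun x => channelOutput H N (useIndex M h.length q i) x ω) (funext fun k => ?_)
  change sumEncode P (queryIndicator (fun k => φ (s k)) (currentWord h)
    (finProdFinEquiv.symm (finProdFinEquiv (q, i))).1 k) (U (useIndex M h.length q i) k ω) = _
  rw [Equiv.symm_apply_apply]

variable [MeasurableSpace Ω] {μ : Measure Ω} [IsProbabilityMeasure μ] {σF σN : ℝ}

theorem peakPowerConstraint (hc : IsFadingChannel μ H N U σF σN) (hP : 0 ≤ P) :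
    (scalableMax K M m φ P ν).PeakPowerConstraint μ s H N U P := by
  have hsign : ∀ᵐ ω ∂μ, ∀ t k, U t k ω = 1 ∨ U t k ω = -1 :=
    ae_all_iff.2 fun t => ae_all_iff.2 fun k => hc.ae_sign t k
  filter_upwards [hsign] with ω hω t i k
  exact norm_sumEncode_sq_le hP (queryIndicator_mem_Icc (fun k => φ (s k)) _ _ k)
    (sq_eq_one_iff.2 (hω _ k))

theorem le_measure_forall_lt_accurate (hc : IsFadingChannel μ H N U σF σN)
    (hσN : 0 ≤ σN) (hK : 0 < K) (hP : 0 < P) (hM : 0 < M) {ε : ℝ} (hε : 0 < ε)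
    (hν : ν = fun t => ∫ ω, ‖N t ω‖ ^ 2 ∂μ) (J : ℕ) :
    ENNReal.ofReal (1 - sumErrorBound M K σF σN P ε) ^ (3 * J) ≤
      μ {ω | ∀ j < J, ω ∈ accurate M P ν (fun k => φ (s k)) H N U ε j
        (currentWord ((scalableMax K M m φ P ν).transcript s H N U ω j))} := by
  have hmeas (j : ℕ) (h : List Message) := measurableSet_accurate M P ν (fun k => φ (s k)) H N U
    (S := Prod.fst ⁻¹' Set.Ico (3 * M * j) (3 * M * (j + 1)))
    (fun q i _ => ⟨le_useIndex j q i, useIndex_lt j q i⟩) ε (currentWord h)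
  subst hν
  rw [pow_mul]
  exact StarProtocol.pow_le_measure_forall_lt_mem_transcript
    (fun k => measurable_symbol k (s k)) measurable_multicast hc
    hmeas (fun j _ => hc.le_measure_accurate hσN hK hP hM hε j _) J

end scalableMax

/-! ### Words and descriptions -/

section Words

variable {b b' : Lex (ℕ → Bool)} {x : List Bool} {n : ℕ}

theorem length_bitPrefix (b : Lex (ℕ → Bool)) (n : ℕ) : (bitPrefix b n).length = n := by
  simp [bitPrefix]

theorem bitPrefix_succ (b : Lex (ℕ → Bool)) (n : ℕ) :
    bitPrefix b (n + 1) = bitPrefix b n ++ [ofLex b n] := by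
  simp [bitPrefix, List.range_succ]

theorem bitPrefix_eq_bitPrefix_iff :
    bitPrefix b n = bitPrefix b' n ↔ ∀ i < n, ofLex b i = ofLex b' i := by
  simp [bitPrefix]

theorem append_singleton_lt_append_singleton_iff {α : Type*} [LT α] [Std.Irrefl (α := α) (· < ·)]
    {x y : List α} (h : x.length = y.length) {a a' : α} :
    x ++ [a] < y ++ [a'] ↔ x < y ∨ x = y ∧ a < a' := by
  induction x generalizing y with
  | nil =>
    obtain rfl : y = [] := List.length_eq_zero_iff.1 h.symm
    simp [List.cons_lt_cons_iff]
  | cons c x ih =>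
    rcases y with _ | ⟨c', y⟩
    · simp at h
    · simp only [List.length_cons, Nat.add_right_cancel_iff] at h
      simp only [List.cons_append, List.cons_lt_cons_iff, ih h, List.cons.injEq]
      tauto

theorem bitPrefix_lt_bitPrefix {i : ℕ} (heq : ∀ j < i, ofLex b j = ofLex b' j)
    (hlt : ofLex b i < ofLex b' i) (hi : i < n) : bitPrefix b n < bitPrefix b' n := by
  induction n, hi using Nat.le_induction with
  | base =>
    rw [bitPrefix_succ, bitPrefix_succ,
      append_singleton_lt_append_singleton_iff (by simp only [length_bitPrefix])]
    exact Or.inr ⟨bitPrefix_eq_bitPrefix_iff.2 heq, hlt⟩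
  | succ n _ ih =>
    rw [bitPrefix_succ, bitPrefix_succ,
      append_singleton_lt_append_singleton_iff (by simp only [length_bitPrefix])]
    exact Or.inl ih

theorem bitPrefix_mono (h : b ≤ b') (n : ℕ) : bitPrefix b n ≤ bitPrefix b' n := by
  rcases h.eq_or_lt with rfl | ⟨i, heq, hlt⟩
  · exact le_rfl
  · rcases le_or_gt n i with hn | hn
    · exact (bitPrefix_eq_bitPrefix_iff.2 fun j hj => heq j (hj.trans_le hn)).le
    · exact (bitPrefix_lt_bitPrefix heq hlt hn).le

theorem IsAbove.mono (h : b ≤ b') (hx : IsAbove x b) : IsAbove x b' :=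
  lt_of_lt_of_le hx (bitPrefix_mono h _)

theorem HasPrefix.isAbove_or_hasPrefix (h : b ≤ b') (hx : HasPrefix x b) :
    IsAbove x b' ∨ HasPrefix x b' :=
  (hx.symm.trans_le (bitPrefix_mono h _)).lt_or_eq.imp_right Eq.symm

theorem isAbove_nil (b : Lex (ℕ → Bool)) : ¬ IsAbove [] b := by
  simp [IsAbove, bitPrefix]

theorem hasPrefix_nil (b : Lex (ℕ → Bool)) : HasPrefix [] b := by
  simp [HasPrefix, bitPrefix]

theorem hasPrefix_append_singleton_iff {c : Bool} :
    HasPrefix (x ++ [c]) b ↔ HasPrefix x b ∧ ofLex b x.length = c := by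
  rw [HasPrefix, HasPrefix, List.length_append, List.length_singleton, bitPrefix_succ,
    List.append_eq_append_iff_of_size_eq_left (length_bitPrefix _ _), List.singleton_inj]

theorem isAbove_append_singleton_iff {c : Bool} :
    IsAbove (x ++ [c]) b ↔ IsAbove x b ∨ HasPrefix x b ∧ c < ofLex b x.length := by
  rw [IsAbove, IsAbove, HasPrefix, List.length_append, List.length_singleton, bitPrefix_succ,
    append_singleton_lt_append_singleton_iff (length_bitPrefix _ _).symm, eq_comm (a := x)]

theorem isAbove_append_true_iff : IsAbove (x ++ [true]) b ↔ IsAbove x b := by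
  simp [isAbove_append_singleton_iff]

theorem isAbove_append_false_iff :
    IsAbove (x ++ [false]) b ↔ IsAbove x b ∨ HasPrefix (x ++ [true]) b := by
  simp [isAbove_append_singleton_iff, hasPrefix_append_singleton_iff, Bool.lt_iff]

theorem isAbove_or_hasPrefix_append_false_iff :
    IsAbove (x ++ [false]) b ∨ HasPrefix (x ++ [false]) b ↔ IsAbove x b ∨ HasPrefix x b := by
  rw [isAbove_append_false_iff, hasPrefix_append_singleton_iff, hasPrefix_append_singleton_iff]
  cases ofLex b x.length <;> simp

end Words

section DescriptionLength

variable {K : ℕ} {b : Fin K → Lex (ℕ → Bool)}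

theorem bitPrefix_descriptionLength_ne (hb : Function.Injective b) {j k : Fin K} (hjk : j ≠ k) :
    bitPrefix (b j) (descriptionLength b k) ≠ bitPrefix (b k) (descriptionLength b k) := by
  have hdiffer (j : Fin K) (hj : j ≠ k) : ∃ i, ofLex (b j) i ≠ ofLex (b k) i :=
    Function.ne_iff.1 fun h => hj (hb (ofLex_inj.1 h))
  choose! i hi using hdiffer
  refine Nat.sInf_mem (s := {n | ∀ j, j ≠ k → bitPrefix (b j) n ≠ bitPrefix (b k) n})
    ⟨Finset.univ.sup i + 1, fun j hj h => hi j hj ?_⟩ j hjk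
  exact bitPrefix_eq_bitPrefix_iff.1 h _ (Nat.lt_succ_of_le (Finset.le_sup (Finset.mem_univ j)))

theorem length_lt_maxDescriptionLength (hb : Function.Injective b) {x : List Bool}
    (h : 1 < {k | HasPrefix x (b k)}.ncard) : x.length < maxDescriptionLength b := by
  obtain ⟨j, k, hj, hk, hjk⟩ := (Set.one_lt_ncard_iff (Set.toFinite _)).1 h
  by_contra! hle
  refine bitPrefix_descriptionLength_ne hb hjk (bitPrefix_eq_bitPrefix_iff.2 fun i hi => ?_)
  exact bitPrefix_eq_bitPrefix_iff.1 (hj.trans hk.symm) i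
    (hi.trans_le ((Finset.le_sup (Finset.mem_univ k)).trans hle))

end DescriptionLength

/-! ### Runs with accurate estimates -/

section Remaining

variable {K : ℕ} {b : Fin K → Lex (ℕ → Bool)} {m : ℕ} {x : List Bool} {e : Fin 3 → ℝ}

/-- The agents that remain if the protocol ends when the current word is `x`: those above `x` and,
if `w` is set, those whose sequences start with `x`. -/
def remaining (b : Fin K → Lex (ℕ → Bool)) (x : List Bool) (w : Bool) : Set (Fin K) :=
  {k | IsAbove x (b k) ∨ (w = true ∧ HasPrefix x (b k))}

theorem remaining_false (b : Fin K → Lex (ℕ → Bool)) (x : List Bool) :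
    remaining b x false = {k | IsAbove x (b k)} := by
  simp [remaining]

theorem remaining_true (b : Fin K → Lex (ℕ → Bool)) (x : List Bool) :
    remaining b x true = {k | IsAbove x (b k)} ∪ {k | HasPrefix x (b k)} := by
  ext k
  simp [remaining]

theorem weakMaxConsensus_of_remaining {α : Type*} [LinearOrder α] {φ : α → Lex (ℕ → Bool)}
    (hφ : Monotone φ) {s : Fin K → α} {w : Bool} {out : Fin K → Bool}
    (hout : {k | out k = true} = remaining (fun k => φ (s k)) x w)
    (hne : (remaining (fun k => φ (s k)) x w).Nonempty)
    (hcard : (remaining (fun k => φ (s k)) x w).ncard ≤ m) : WeakMaxConsensus m s out := by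
  rw [← hout] at hne hcard
  refine ⟨hne, hcard, fun i j hi hj => ?_⟩
  by_contra! hle
  have hi' : i ∈ remaining (fun k => φ (s k)) x w := hout ▸ hi
  have hj' : j ∈ remaining (fun k => φ (s k)) x w := by
    rcases hi' with habove | ⟨hw, hprefix⟩
    · exact Or.inl (habove.mono (hφ hle))
    · exact (hprefix.isAbove_or_hasPrefix (hφ hle)).imp_right fun h => ⟨hw, h⟩
  rw [← hout, Set.mem_ofPred_eq, hj] at hj'
  exact Bool.false_ne_true hj'

/-- The invariant of the current word `x` in a run with accurate estimates: some agent is above `x`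
or has `x` as a prefix, and at most `m` agents are above `x`. -/
structure Admissible (b : Fin K → Lex (ℕ → Bool)) (m : ℕ) (x : List Bool) : Prop where
  nonempty : (remaining b x true).Nonempty
  ncard_le : (remaining b x false).ncard ≤ m

theorem admissible_nil (hK : 0 < K) (b : Fin K → Lex (ℕ → Bool)) (m : ℕ) :
    Admissible b m [] where
  nonempty := ⟨⟨0, hK⟩, Or.inr ⟨rfl, hasPrefix_nil _⟩⟩
  ncard_le := by simp [remaining_false, isAbove_nil]

theorem Admissible.append_true (hx : Admissible b m x)
    (hprefix : {k | HasPrefix (x ++ [true]) (b k)}.Nonempty) : Admissible b m (x ++ [true]) where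
  nonempty := hprefix.mono fun _ h => Or.inr ⟨rfl, h⟩
  ncard_le := by simpa only [remaining_false, isAbove_append_true_iff] using hx.ncard_le

theorem Admissible.append_false (hx : Admissible b m x)
    (hcard : {k | IsAbove x (b k)}.ncard + {k | HasPrefix (x ++ [true]) (b k)}.ncard ≤ m) :
    Admissible b m (x ++ [false]) where
  nonempty := hx.nonempty.mono fun k => by
    simp [remaining, isAbove_or_hasPrefix_append_false_iff]
  ncard_le := by
    simp only [remaining_false, isAbove_append_false_iff]
    exact (Set.ncard_union_le _ _).trans hcard

variable (hx : Admissible b m x)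
  (he : ∀ q, |e q - {k | Query x (b k) q}.ncard| < (m : ℝ) / 4)

include hx he

theorem remaining_of_react_eq_finish {w : Bool} (hr : react m e = .finish w) :
    (remaining b x w).Nonempty ∧ (remaining b x w).ncard ≤ m := by
  have hAbove : |e 0 - {k | IsAbove x (b k)}.ncard| < (m : ℝ) / 4 := he 0
  have hPrefix : |e 1 - {k | HasPrefix x (b k)}.ncard| < (m : ℝ) / 4 := he 1
  rw [abs_lt] at hAbove hPrefix
  unfold react at hr
  split_ifs at hr with he₀ he₁
  · obtain rfl : false = w := by simpa using hr
    have hpos : (0 : ℝ) < {k | IsAbove x (b k)}.ncard := by linarith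
    refine ⟨?_, hx.ncard_le⟩
    rw [remaining_false]
    exact Set.nonempty_of_ncard_ne_zero (Nat.cast_pos.1 hpos).ne'
  · obtain rfl : true = w := by simpa using hr
    have hlt : ({k | IsAbove x (b k)}.ncard + {k | HasPrefix x (b k)}.ncard : ℝ) < m + 1 := by
      linarith
    refine ⟨hx.nonempty, ?_⟩
    rw [remaining_true]
    exact (Set.ncard_union_le _ _).trans (Nat.lt_succ_iff.1 (by exact_mod_cast hlt))

theorem Admissible.append_of_react_eq {c : Bool} (hr : react m e = .append c) :
    Admissible b m (x ++ [c]) := by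
  have hAbove : |e 0 - {k | IsAbove x (b k)}.ncard| < (m : ℝ) / 4 := he 0
  have hTrue : |e 2 - {k | HasPrefix (x ++ [true]) (b k)}.ncard| < (m : ℝ) / 4 := he 2
  rw [abs_lt] at hAbove hTrue
  unfold react at hr
  split_ifs at hr with he₀ he₁ he₂
  · obtain rfl : true = c := by simpa using hr
    have hpos : (0 : ℝ) < {k | HasPrefix (x ++ [true]) (b k)}.ncard := by linarith
    exact hx.append_true (Set.nonempty_of_ncard_ne_zero (Nat.cast_pos.1 hpos).ne')
  · obtain rfl : false = c := by simpa using hr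
    have hle : ({k | IsAbove x (b k)}.ncard + {k | HasPrefix (x ++ [true]) (b k)}.ncard : ℝ)
        ≤ m := by
      linarith
    exact hx.append_false (by exact_mod_cast hle)

omit hx in
theorem one_lt_ncard_hasPrefix_of_react_eq_append {c : Bool} (hr : react m e = .append c) :
    1 < {k | HasPrefix x (b k)}.ncard := by
  have hPrefix : |e 1 - {k | HasPrefix x (b k)}.ncard| < (m : ℝ) / 4 := he 1
  have he₁ : (m : ℝ) / 4 + 1 ≤ e 1 := by
    unfold react at hr
    split_ifs at hr with _ he₁ <;> exact not_lt.1 he₁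
  have hlt : (1 : ℝ) < {k | HasPrefix x (b k)}.ncard := by
    linarith [(abs_lt.1 hPrefix).2]
  exact_mod_cast hlt

end Remaining

theorem currentWord_concat_append (h : List Message) (c : Bool) :
    currentWord (h ++ [.append c]) = currentWord h ++ [c] := by
  simp [currentWord]

theorem currentWord_concat_finish (h : List Message) (w : Bool) :
    currentWord (h ++ [.finish w]) = currentWord h := by
  simp [currentWord]

/-- The state of a run with accurate estimates after the multicasts `h`, as long as it has not
ended. -/
structure OnTrack {K : ℕ} (b : Fin K → Lex (ℕ → Bool)) (m : ℕ) (h : List Message) : Prop where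
  eq_map_append : h = (currentWord h).map .append
  admissible : Admissible b m (currentWord h)
  length_le : h.length ≤ maxDescriptionLength b

namespace OnTrack

variable {K m : ℕ} {b : Fin K → Lex (ℕ → Bool)} {h : List Message}

theorem nil (hK : 0 < K) : OnTrack b m [] where
  eq_map_append := rfl
  admissible := admissible_nil hK b m
  length_le := Nat.zero_le _

theorem length_currentWord (hh : OnTrack b m h) : (currentWord h).length = h.length := by
  conv_rhs => rw [hh.eq_map_append, List.length_map]

theorem concat_append (hh : OnTrack b m h) (hb : Function.Injective b) {e : Fin 3 → ℝ}
    (he : ∀ q, |e q - {k | Query (currentWord h) (b k) q}.ncard| < (m : ℝ) / 4) {c : Bool}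
    (hr : react m e = .append c) : OnTrack b m (h ++ [.append c]) where
  eq_map_append := by
    rw [currentWord_concat_append, List.map_append, ← hh.eq_map_append, List.map_singleton]
  admissible := by
    rw [currentWord_concat_append]
    exact hh.admissible.append_of_react_eq he hr
  length_le := by
    rw [List.length_append, ← hh.length_currentWord]
    exact length_lt_maxDescriptionLength hb (one_lt_ncard_hasPrefix_of_react_eq_append he hr)

end OnTrack

namespace scalableMax

variable {Ω α : Type*} {K M m : ℕ} {φ : α → Lex (ℕ → Bool)} {P : ℝ} {ν : ℕ → ℝ} {s : Fin K → α}
  {H : ℕ → Fin K → Ω → ℂ} {N : ℕ → Ω → ℂ} {U : ℕ → Fin K → Ω → ℝ} {ω : Ω} {h : List Message}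

theorem halted_concat_finish (w : Bool) :
    (scalableMax K M m φ P ν).halted (h ++ [.finish w]) = true := by
  simp [scalableMax]

theorem not_halted_of_onTrack {b : Fin K → Lex (ℕ → Bool)} (hh : OnTrack b m h) :
    (scalableMax K M m φ P ν).halted h = false := by
  rw [hh.eq_map_append]
  rcases hlast : (currentWord h).getLast? with _ | c <;>
    simp [scalableMax, List.getLast?_map, hlast]

theorem setOf_decision_concat_finish (w : Bool) :
    {k | (scalableMax K M m φ P ν).decision k (s k) (h ++ [.finish w]) = true} =
      remaining (fun k => φ (s k)) (currentWord h) w := by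
  simp [scalableMax, remaining, currentWord_concat_finish]

variable [LinearOrder α]

theorem transcript_succeeds_or_onTrack (hK : 0 < K) (hφ : StrictMono φ)
    (hs : Function.Injective s) {J : ℕ}
    (hω : ∀ j < J, ω ∈ accurate M P ν (fun k => φ (s k)) H N U ((m : ℝ) / 4) j
      (currentWord ((scalableMax K M m φ P ν).transcript s H N U ω j))) {j : ℕ} (hj : j ≤ J) :
    ((scalableMax K M m φ P ν).halted ((scalableMax K M m φ P ν).transcript s H N U ω j) = true ∧
      WeakMaxConsensus m s fun k => (scalableMax K M m φ P ν).decision k (s k)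
        ((scalableMax K M m φ P ν).transcript s H N U ω j)) ∨
    ((scalableMax K M m φ P ν).transcript s H N U ω j).length = j ∧
      OnTrack (fun k => φ (s k)) m ((scalableMax K M m φ P ν).transcript s H N U ω j) := by
  induction j with
  | zero => exact Or.inr ⟨rfl, .nil hK⟩
  | succ j ih =>
    have haccurate := hω j hj
    rw [StarProtocol.transcript_succ]
    set h := (scalableMax K M m φ P ν).transcript s H N U ω j
    rcases ih (Nat.le_of_succ_le hj) with hsuccess | ⟨hlength, hh⟩
    · exact Or.inl (by rwa [if_pos hsuccess.1])
    rw [if_neg (by simp [not_halted_of_onTrack hh]), reply_eq_react_estimate, hlength]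
    rcases hr : react m fun q =>
        estimate M P ν (fun k => φ (s k)) H N U j (currentWord h) q ω with c | w
    · exact Or.inr ⟨by simp [hlength],
        hh.concat_append (hφ.injective.comp hs) haccurate hr⟩
    · obtain ⟨hne, hcard⟩ := remaining_of_react_eq_finish hh.admissible haccurate hr
      exact Or.inl ⟨halted_concat_finish w, weakMaxConsensus_of_remaining hφ.monotone
        (setOf_decision_concat_finish w) hne hcard⟩

theorem reaches_of_accurate (hK : 0 < K) (hφ : StrictMono φ) (hs : Function.Injective s) {d : ℕ}
    (hd : d = maxDescriptionLength fun k => φ (s k))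
    (hω : ∀ j < d + 1, ω ∈ accurate M P ν (fun k => φ (s k)) H N U ((m : ℝ) / 4) j
      (currentWord ((scalableMax K M m φ P ν).transcript s H N U ω j))) :
    (scalableMax K M m φ P ν).Reaches m s H N U (3 * M * (d + 1)) (d + 1) ω := by
  have hlength := (scalableMax K M m φ P ν).length_transcript_le s H N U ω (d + 1)
  rcases transcript_succeeds_or_onTrack hK hφ hs hω le_rfl with ⟨hhalted, hweak⟩ | ⟨heq, htrack⟩
  · exact ⟨d + 1, hhalted, Nat.mul_le_mul_left _ hlength, hlength, hweak⟩
  · have := htrack.length_le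
    omega

end scalableMax

theorem StarProtocol.Reaches.mono {K : ℕ} {α Msg Ω : Type*} [LinearOrder α]
    {p : StarProtocol K α Msg} {m : ℕ} {s : Fin K → α} {H : ℕ → Fin K → Ω → ℂ} {N : ℕ → Ω → ℂ}
    {U : ℕ → Fin K → Ω → ℝ} {a a' b b' : ℕ} (ha : a ≤ a') (hb : b ≤ b') {ω : Ω}
    (h : p.Reaches m s H N U a b ω) : p.Reaches m s H N U a' b' ω :=
  let ⟨t, hhalted, huses, hlength, hweak⟩ := h
  ⟨t, hhalted, huses.trans ha, hlength.trans hb, hweak⟩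

end MaxConsensus

theorem mainTheorem4_general {Ω : Type*} [MeasurableSpace Ω] (μ : Measure Ω)
    [IsProbabilityMeasure μ] {K : ℕ} (hK : 0 < K) {σF σN P : ℝ} (hσN : 0 ≤ σN) (hP : 0 < P)
    (H : ℕ → Fin K → Ω → ℂ) (N : ℕ → Ω → ℂ) (U : ℕ → Fin K → Ω → ℝ)
    (hchannel : IsFadingChannel μ H N U σF σN)
    {α : Type*} [LinearOrder α] (φ : α → Lex (ℕ → Bool)) (hφ : StrictMono φ)
    (M m : ℕ) (hM : 0 < M) (hm : 0 < m)
    (γ : ℝ) (hγ : γ = sumErrorBound M K σF σN P ((m : ℝ) / 4)) (hγ_le : γ ≤ 1)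
    (p : StarProtocol K α Message)
    (hp : p = scalableMax K M m φ P (fun t => ∫ ω, ‖N t ω‖ ^ 2 ∂μ))
    (s : Fin K → α) (hs : Function.Injective s)
    (d : ℕ) (hd : d = maxDescriptionLength (fun k => φ (s k))) :
    p.PeakPowerConstraint μ s H N U P ∧
    (1 - γ) ^ (3 * (d + 1)) ≤
      μ.real {ω | p.Reaches m s H N U (3 * M * (d + 1)) (d + 1) ω} := by
  subst hp
  refine ⟨scalableMax.peakPowerConstraint hchannel hP.le, ?_⟩
  have haccurate := scalableMax.le_measure_forall_lt_accurate (m := m) (φ := φ) (s := s) hchannel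
    hσN hK hP hM (ε := (m : ℝ) / 4) (by positivity) rfl (d + 1)
  rw [← hγ, ← ENNReal.ofReal_pow (sub_nonneg.2 hγ_le),
    ENNReal.ofReal_le_iff_le_toReal (measure_ne_top _ _)] at haccurate
  exact haccurate.trans (measureReal_mono fun ω hω =>
    scalableMax.reaches_of_accurate hK hφ hs hd hω)

theorem mainTheorem4 {Ω : Type*} [MeasurableSpace Ω] (μ : Measure Ω) [IsProbabilityMeasure μ]
    {K : ℕ} (hK : 0 < K) {σF σN P : ℝ} (hσF : 0 ≤ σF) (hσN : 0 ≤ σN) (hP : 0 < P)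
    (H : ℕ → Fin K → Ω → ℂ) (N : ℕ → Ω → ℂ) (U : ℕ → Fin K → Ω → ℝ)
    (hchannel : IsFadingChannel μ H N U σF σN)
    {α : Type*} [LinearOrder α] (φ : α → Lex (ℕ → Bool)) (hφ : StrictMono φ)
    (M m : ℕ) (hM : 0 < M) (hm : 0 < m) (hm_even : Even m)
    (γ : ℝ) (hγ : γ = sumErrorBound M K σF σN P ((m : ℝ) / 4)) (hγ_le : γ ≤ 1)
    (p : StarProtocol K α Message)
    (hp : p = scalableMax K M m φ P (fun t => ∫ ω, ‖N t ω‖ ^ 2 ∂μ))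
    (s : Fin K → α) (hs : Function.Injective s)
    (d : ℕ) (hd : d = maxDescriptionLength (fun k => φ (s k))) :
    p.PeakPowerConstraint μ s H N U P ∧
    (1 - γ) ^ (3 * (d + 1)) ≤
      μ.real {ω | p.Reaches m s H N U (3 * M * (d + 1)) (M * (d + 1)) ω} := by
  obtain ⟨hpower, hreaches⟩ := mainTheorem4_general μ hK hσN hP H N U hchannel φ hφ M m hM hm γ hγ
    hγ_le p hp s hs d hd
  exact ⟨hpower, hreaches.trans <| measureReal_mono fun ω hω =>
    hω.mono le_rfl (Nat.le_mul_of_pos_left _ hM)⟩
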